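/- All manifolds are smooth, Hausdorff, $\sigma$-compact, finite-dimensional and without boundary. For a Lie algebroid $\mathcal A\to M$, an $\mathcal A$-distribution of rank $r$ is a rank-$r$ smooth subbundle $\xi\subset\mathcal A$. Its Lie flag is given by $\Gamma(\xi)^{(1)}=\Gamma(\xi)$ and $\Gamma(\xi)^{(i+1)}=\Gamma(\xi)^{(i)}+\langle [v,w] : v\in\Gamma(\xi),\,w\in\Gamma(\xi)^{(i)}\rangle_{C^\infty}$ (generated as a sheaf of $C^\infty$-modules). It is *regular* if each $\Gamma(\xi)^{(i)}$, $i\ge1$, is $\Gamma(\xi_i)$ for a distribution $\xi_i$ (set $\xi_0=0$); then its curvatures are the maps $\Omega_{i,j}(\xi):\xi_i\times\xi_j\to\xi_{i+j}/\xi_{i+j-1}$ induced by the bracket $(v,w)\mapsto[v,w]$, for $i,j\ge 1$. It is *bracket-generating* if $\Gamma(\xi)^{(i)}=\Gamma(\mathcal A)$ for some $i$, and *involutive* if $\Gamma(\xi)^{(i)}=\Gamma(\xi)$ for all $i\ge 1$. An *$\mathcal A$-contact structure* ($\operatorname{rank}\mathcal A=2r+1$) is a corank-one distribution $\xi$ with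 $\Omega_{1,1}(\xi):\xi\times\xi\to\mathcal A/\xi$ nondegenerate; an *$\mathcal A$-contact form* is a $1$-form $\alpha$ on $\mathcal A$ with $\alpha\wedge(d\alpha)^r$ nowhere zero; an *$\mathcal A$-symplectic form* ($\operatorname{rank}\mathcal A=2r$) is a closed $2$-form $\omega$ on $\mathcal A$ with $\omega^r$ nowhere zero. A *Lie algebroid submersion* $\Psi:\mathcal B\to\mathcal A$ is a fibrewise surjective Lie algebroid morphism over a surjective submersion $N\to M$. **(1)** Let $\mathcal A\to M$ and $\mathcal B\to N$ be Lie algebroids of the same rank, $\Psi:\mathcal B\to\mathcal A$ a Lie algebroid submersion, and $\xi\subset\mathcal A$ a regular distribution. Then the preimage $\Psi^*\xi\subset\mathcal B$ is a regular distribution of the same rank, mapped fibrewise isomorphically onto $\xi$ by $\Psi$, and $(\Psi^*\xi)_i=\Psi^*(\xi_i)$ for all $i$. The curvatures of $\xi$ and $\Psi^*\xi$ are well defined and correspond under $\Psi$, that is, $\Psi\big(\Omega_{i,j}(\Psi^*\xi)(a,b)\big)=\Omega_{i,j}(\xi)(\Psi a,\Psi b)$. Moreover $\Psi^*\xi$ is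 bracket-generating if and only if $\xi$ is, and involutive if and only if $\xi$ is. **(2)** Let $k\ge1$, let $Z\subset M$ be a closed embedded coorientable hypersurface with ideal $I_Z$ of functions vanishing on $Z$, and let $j\in C^\infty(M)/I_Z^k$ be a $(k-1)$-jet along $Z$ with vanishing zero-jet and, if $k\ge 2$, nowhere vanishing first jet (so $j=0$ if $k=1$). Let $\mathcal A_Z^k$ be the associated $b^k$-tangent bundle, i.e. the Lie algebroid of rank $\dim M$ whose sections are, via the anchor, the vector fields $X$ with $\mathcal L_Xf\in I_Z^k$ for all $f$ representing $j$. Let $(M\times\mathbb S^1,\mathcal F)$ be a regularisation of $\mathcal A_Z^k$: a codimension-one foliation $\mathcal F$ with a Lie algebroid submersion $\Psi:\mathcal F\to\mathcal A_Z^k$ over the projection $M\times\mathbb S^1\to M$. Then: * for every $b^k$-contact structure $\xi\subset\mathcal A_Z^k$, the preimage $\Psi^*\xi$ is a contact structure on $\mathcal F$ lifting $\xi$ (it is mapped fibrewise isomorphically onto $\xi$); for every $b^k$-contact form $\alpha$, the pullback $\Psi^*\alpha$ is a contact form on $\mathcal F$; * for every $b^k$-symplectic form $\omega$ on $\mathcal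 A_Z^k$, the pullback $\Psi^*\omega$ is a symplectic form on $\mathcal F$; * for every regular distribution $\xi\subset\mathcal A_Z^k$, $\Psi^*\xi$ is a regular distribution lifting $\xi$ with all the properties in (1), and it is $\mathbb S^1$-invariant if $\mathcal F$ is. The last item also holds with $\mathbb S^1$ replaced by $\mathbb R$. -/

import Mathlib

open Set Filter Topology Module Bundle
open scoped Manifold ContDiff

universe u

section Basic

variable {E : Type*} [NormedAddCommGroup E] [NormedSpace ℝ E]
  {H : Type*} [TopologicalSpace H] (I : ModelWithCorners ℝ E H)

/-- The derivative at `x` of a real function `f` in the direction of the tangent vector `X`. -/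
noncomputable def dirDeriv {M : Type*} [TopologicalSpace M] [ChartedSpace H M]
    (f : M → ℝ) (x : M) (X : TangentSpace I x) : ℝ :=
  mfderiv I 𝓘(ℝ, ℝ) f x X

/-! ## Lie algebroids -/

variable (M : Type*) [TopologicalSpace M] [ChartedSpace H M] [IsManifold I ∞ M]

/-- A Lie algebroid on the manifold `M`: a smooth real vector bundle of finite rank (fibres
`Fibre x`, model fibre `Model`), a smooth bundle morphism `anchor` to the tangent bundle, and a Lie
bracket on the space of smooth sections which satisfies the Leibniz rule. -/
structure LieAlgebroid where
  Model : Type u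
  [normedAddCommGroup : NormedAddCommGroup Model]
  [normedSpace : NormedSpace ℝ Model]
  [finiteDimensional : FiniteDimensional ℝ Model]
  Fibre : M → Type u
  [addCommGroup : ∀ x, AddCommGroup (Fibre x)]
  [module : ∀ x, Module ℝ (Fibre x)]
  [fibreTopology : ∀ x, TopologicalSpace (Fibre x)]
  [totalTopology : TopologicalSpace (TotalSpace Model Fibre)]
  [fiberBundle : FiberBundle Model Fibre]
  [vectorBundle : VectorBundle ℝ Model Fibre]
  [smoothBundle : ContMDiffVectorBundle ∞ Model Fibre I]
  anchor : ∀ x, Fibre x →ₗ[ℝ] TangentSpace I x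
  anchor_smooth : ContMDiff (I.prod 𝓘(ℝ, Model)) I.tangent ∞
    (fun p : TotalSpace Model Fibre => (⟨p.1, anchor p.1 p.2⟩ : TangentBundle I M))
  bracket : Cₛ^∞⟮I; Model, Fibre⟯ →ₗ[ℝ] Cₛ^∞⟮I; Model, Fibre⟯ →ₗ[ℝ] Cₛ^∞⟮I; Model, Fibre⟯
  bracket_self : ∀ v, bracket v v = 0
  jacobi : ∀ u v w,
    bracket u (bracket v w) + bracket v (bracket w u) + bracket w (bracket u v) = 0
  leibniz : ∀ (v w fw : Cₛ^∞⟮I; Model, Fibre⟯) (f : C^∞⟮I, M; ℝ⟯),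
    (∀ x, fw x = f x • w x) → ∀ x,
      bracket v fw x = f x • bracket v w x +
        dirDeriv I f x (anchor x (v x)) • w x

end Basic

attribute [instance] LieAlgebroid.normedAddCommGroup LieAlgebroid.normedSpace
  LieAlgebroid.finiteDimensional LieAlgebroid.addCommGroup LieAlgebroid.module
  LieAlgebroid.fibreTopology LieAlgebroid.totalTopology LieAlgebroid.fiberBundle
  LieAlgebroid.vectorBundle LieAlgebroid.smoothBundle

namespace LieAlgebroid

section Single

variable {E : Type*} [NormedAddCommGroup E] [NormedSpace ℝ E]
  {H : Type*} [TopologicalSpace H] {I : ModelWithCorners ℝ E H}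
  {M : Type*} [TopologicalSpace M] [ChartedSpace H M] [IsManifold I ∞ M]
  (A : LieAlgebroid.{u} I M)

/-- The rank of the underlying vector bundle. -/
noncomputable def rank : ℕ := finrank ℝ A.Model

/-- The smooth sections `Γ(A)`. -/
abbrev Sec : Type _ := Cₛ^∞⟮I; A.Model, A.Fibre⟯

/-- Multiplication of a section by a smooth function. -/
noncomputable instance instSMulSec : SMul C^∞⟮I, M; ℝ⟯ A.Sec where
  smul f v := ⟨fun x => f x • v x, f.contMDiff.smul_section v.contMDiff⟩

theorem smul_apply (f : C^∞⟮I, M; ℝ⟯) (v : A.Sec) (x : M) : (f • v) x = f x • v x := rfl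

/-- `Γ(A)` is a module over the smooth functions. -/
noncomputable instance instModuleSec : Module C^∞⟮I, M; ℝ⟯ A.Sec where
  one_smul v := by ext x; exact one_smul ℝ (v x)
  mul_smul f g v := by ext x; exact mul_smul (f x) (g x) (v x)
  smul_zero f := by ext x; exact smul_zero (f x)
  smul_add f v w := by ext x; exact smul_add (f x) (v x) (w x)
  add_smul f g v := by ext x; exact add_smul (f x) (g x) (v x)
  zero_smul v := by ext x; exact zero_smul ℝ (v x)

/-- The derivative of `f` at `x` along the vector field `ρ(v)`. -/
noncomputable def lieDeriv (v : A.Sec) (f : M → ℝ) (x : M) : ℝ :=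
  dirDeriv I f x (A.anchor x (v x))

/-- A Lie algebroid is a (regular) foliation if its anchor is fibrewise injective. The foliation as
a subbundle of the tangent bundle is the image of the anchor. -/
def IsFoliation : Prop := ∀ x, Function.Injective (A.anchor x)

/-! ### Distributions and their Lie flag -/

/-- A family of subspaces of the fibres. -/
abbrev Family : Type _ := ∀ x, Submodule ℝ (A.Fibre x)

/-- `ξ` is an `A`-distribution of rank `k`: a smooth subbundle of rank `k`, that is, near
every point it is framed by `k` smooth sections. (By multiplying with a bump function, the sections
of a local frame may be taken to be defined on all of `M`.) -/
def IsDistribution (ξ : A.Family) (k : ℕ) : Prop :=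
  ∀ x, ∃ s : Fin k → A.Sec, ∀ᶠ y in 𝓝 x,
    LinearIndependent ℝ (fun i => s i y) ∧ Submodule.span ℝ (range fun i => s i y) = ξ y

/-- The module `Γ(ξ)` of sections of `A` with values in `ξ`. -/
noncomputable def sections (ξ : A.Family) : Submodule C^∞⟮I, M; ℝ⟯ A.Sec where
  carrier := {v | ∀ x, v x ∈ ξ x}
  add_mem' hv hw x := (ξ x).add_mem (hv x) (hw x)
  zero_mem' x := (ξ x).zero_mem
  smul_mem' f _ hv x := (ξ x).smul_mem (f x) (hv x)

/-- The (global sections of the) sheaf generated by a module `S` of sections: the sections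
which near each point agree with a member of `S`. -/
noncomputable def sheafify (S : Submodule C^∞⟮I, M; ℝ⟯ A.Sec) : Submodule C^∞⟮I, M; ℝ⟯ A.Sec where
  carrier := {v | ∀ x, ∃ w ∈ S, ∀ᶠ y in 𝓝 x, v y = w y}
  add_mem' {v v'} hv hv' x := by
    obtain ⟨w, hw, h⟩ := hv x
    obtain ⟨w', hw', h'⟩ := hv' x
    refine ⟨w + w', S.add_mem hw hw', ?_⟩
    filter_upwards [h, h'] with y hy hy'
    change v y + v' y = w y + w' y
    rw [hy, hy']
  zero_mem' x := ⟨0, S.zero_mem, Eventually.of_forall fun _ => rfl⟩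
  smul_mem' f v hv x := by
    obtain ⟨w, hw, h⟩ := hv x
    refine ⟨f • w, S.smul_mem f hw, ?_⟩
    filter_upwards [h] with y hy
    rw [smul_apply, smul_apply, hy]

/-- The Lie flag `Γ(ξ)⁽ⁱ⁾` of `ξ`: the first term is `Γ(ξ)`, and each further term is generated over
the smooth functions, as a sheaf, by the preceding one and by its brackets with `Γ(ξ)`. The term of
index `0` is zero by convention. -/
noncomputable def lieFlag (ξ : A.Family) : ℕ → Submodule C^∞⟮I, M; ℝ⟯ A.Sec
  | 0 => ⊥
  | 1 => A.sections ξ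
  | i + 2 => A.sheafify (lieFlag ξ (i + 1) ⊔
      Submodule.span C^∞⟮I, M; ℝ⟯
        {u | ∃ v ∈ A.sections ξ, ∃ w ∈ lieFlag ξ (i + 1), u = A.bracket v w})

/-- The fibre at `x` of the `i`-th term of the Lie flag: the values at `x` of its members. If `ξ` is
regular this is the fibre of the distribution `ξᵢ` with `Γ(ξᵢ) = Γ(ξ)⁽ⁱ⁾`. -/
noncomputable def flagFibre (ξ : A.Family) (i : ℕ) : A.Family := fun x =>
  { carrier := {e | ∃ v ∈ A.lieFlag ξ i, v x = e}
    add_mem' := by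
      rintro _ _ ⟨v, hv, rfl⟩ ⟨w, hw, rfl⟩
      exact ⟨v + w, Submodule.add_mem _ hv hw, rfl⟩
    zero_mem' := ⟨0, Submodule.zero_mem _, rfl⟩
    smul_mem' := by
      rintro c _ ⟨v, hv, rfl⟩
      exact ⟨(ContMDiffMap.const c : C^∞⟮I, M; ℝ⟯) • v, Submodule.smul_mem _ _ hv, rfl⟩ }

/-- `ξ` is a regular distribution: it is a distribution, and so is each term of its Lie flag. -/
def IsRegular (ξ : A.Family) : Prop :=
  (∃ k, A.IsDistribution ξ k) ∧
    ∀ i, 1 ≤ i → ∃ (η : A.Family) (k : ℕ), A.IsDistribution η k ∧ A.sections η = A.lieFlag ξ i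

/-- `ξ` is bracket-generating: some term of the Lie flag is all of `Γ(A)`. -/
def IsBracketGenerating (ξ : A.Family) : Prop := ∃ i, A.lieFlag ξ i = ⊤

/-- `ξ` is involutive: all terms of the Lie flag are equal to `Γ(ξ)`. -/
def IsInvolutive (ξ : A.Family) : Prop := ∀ i, 1 ≤ i → A.lieFlag ξ i = A.sections ξ

/-- The curvature `Curv_{i,j}(ξ)` at `x`: the class modulo `ξ_{i+j-1}` of the value at `x` of the
bracket of a section in `Γ(ξ)⁽ⁱ⁾` through `a` with a section in `Γ(ξ)⁽ʲ⁾` through `b`. -/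
noncomputable def curvature (ξ : A.Family) (i j : ℕ) (x : M)
    (a : A.flagFibre ξ i x) (b : A.flagFibre ξ j x) :
    A.Fibre x ⧸ A.flagFibre ξ (i + j - 1) x :=
  Submodule.Quotient.mk (A.bracket a.2.choose b.2.choose x)

/-- The curvatures of `ξ` are well defined (they do not depend on the chosen sections) and
`Curv_{i,j}(ξ)` takes values in `ξ_{i+j} / ξ_{i+j-1}`. -/
def CurvatureWellDefined (ξ : A.Family) : Prop :=
  ∀ i j, 1 ≤ i → 1 ≤ j → ∀ (v w : A.Sec) (hv : v ∈ A.lieFlag ξ i) (hw : w ∈ A.lieFlag ξ j),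
    A.bracket v w ∈ A.lieFlag ξ (i + j) ∧
    ∀ x, A.curvature ξ i j x ⟨v x, v, hv, rfl⟩ ⟨w x, w, hw, rfl⟩ =
      Submodule.Quotient.mk (A.bracket v w x)

/-! ### Contact and symplectic structures -/

/-- `ξ` is an `A`-contact structure: `A` has rank `2r+1`, `ξ` has corank one, and the first
curvature `Curv_{1,1}(ξ) : ξ × ξ → A/ξ` is nondegenerate. -/
def IsContactStructure (ξ : A.Family) : Prop :=
  ∃ r, A.rank = 2 * r + 1 ∧ A.IsDistribution ξ (2 * r) ∧
    ∀ x (a : A.flagFibre ξ 1 x), (∀ b, A.curvature ξ 1 1 x a b = 0) → a = 0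

/-- A (not necessarily smooth) `1`-form on `A`. -/
abbrev OneForm : Type _ := ∀ x, A.Fibre x →ₗ[ℝ] ℝ

/-- A (not necessarily smooth or alternating) bilinear form on `A`. -/
abbrev BilinForm : Type _ := ∀ x, A.Fibre x →ₗ[ℝ] A.Fibre x →ₗ[ℝ] ℝ

/-- The function `dα(v, w)`, by the Koszul formula. -/
noncomputable def dOne (α : A.OneForm) (v w : A.Sec) (x : M) : ℝ :=
  A.lieDeriv v (fun y => α y (w y)) x - A.lieDeriv w (fun y => α y (v y)) x
    - α x (A.bracket v w x)

/-- The function `dΩ(u, v, w)`, by the Koszul formula. -/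
noncomputable def dTwo (Ω : A.BilinForm) (u v w : A.Sec) (x : M) : ℝ :=
  A.lieDeriv u (fun y => Ω y (v y) (w y)) x - A.lieDeriv v (fun y => Ω y (u y) (w y)) x
    + A.lieDeriv w (fun y => Ω y (u y) (v y)) x
    - Ω x (A.bracket u v x) (w x) + Ω x (A.bracket u w x) (v x) - Ω x (A.bracket v w x) (u x)

/-- `α` is an `A`-contact form: a smooth `1`-form on `A`, of rank `2r+1`, such that the top
degree form `α ∧ (dα)^r` vanishes nowhere. It is written out, up to a positive factor, as the
alternating sum over all permutations of the `2r+1` arguments. -/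
def IsContactForm (α : A.OneForm) : Prop :=
  (∀ v : A.Sec, ContMDiff I 𝓘(ℝ, ℝ) ∞ (fun x => α x (v x))) ∧
  ∃ r, A.rank = 2 * r + 1 ∧ ∀ x, ∃ v : Fin (2 * r + 1) → A.Sec,
    ∑ σ : Equiv.Perm (Fin (2 * r + 1)), ((Equiv.Perm.sign σ : ℤ) : ℝ) *
      (α x (v (σ 0) x) * ∏ i : Fin r,
        A.dOne α (v (σ ⟨2 * i + 1, by omega⟩)) (v (σ ⟨2 * i + 2, by omega⟩)) x) ≠ 0

/-- `Ω` is an `A`-symplectic form: a smooth closed `2`-form on `A`, of rank `2r`, such that the top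
degree form `Ω^r` vanishes nowhere. It is written out, up to a positive factor, as the alternating
sum over all permutations of the `2r` arguments. -/
def IsSymplecticForm (Ω : A.BilinForm) : Prop :=
  (∀ x a, Ω x a a = 0) ∧
  (∀ v w : A.Sec, ContMDiff I 𝓘(ℝ, ℝ) ∞ (fun x => Ω x (v x) (w x))) ∧
  (∀ (u v w : A.Sec) (x : M), A.dTwo Ω u v w x = 0) ∧
  ∃ r, A.rank = 2 * r ∧ ∀ x, ∃ v : Fin (2 * r) → A.Fibre x,
    ∑ σ : Equiv.Perm (Fin (2 * r)), ((Equiv.Perm.sign σ : ℤ) : ℝ) *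
      ∏ i : Fin r, Ω x (v (σ ⟨2 * i, by omega⟩)) (v (σ ⟨2 * i + 1, by omega⟩)) ≠ 0

/-- The image of `ξ` under the anchor is invariant under the diffeomorphisms `τ t`. For `ξ = ⊤` and
`A` a foliation this is invariance of the foliation. -/
def IsInvariant {G : Type*} (τ : G → M → M) (ξ : A.Family) : Prop :=
  ∀ t x, ((ξ x).map (A.anchor x)).map (mfderiv I I (τ t) x).toLinearMap =
    (ξ (τ t x)).map (A.anchor (τ t x))

end Single

/-! ## Morphisms and pullbacks -/

section Morphisms

variable {E : Type*} [NormedAddCommGroup E] [NormedSpace ℝ E]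
  {H : Type*} [TopologicalSpace H] {I : ModelWithCorners ℝ E H}
  {M : Type*} [TopologicalSpace M] [ChartedSpace H M] [IsManifold I ∞ M]
  {E' : Type*} [NormedAddCommGroup E'] [NormedSpace ℝ E']
  {H' : Type*} [TopologicalSpace H'] {J : ModelWithCorners ℝ E' H'}
  {N : Type*} [TopologicalSpace N] [ChartedSpace H' N] [IsManifold J ∞ N]

/-- A Lie algebroid morphism from `B → N` to `A → M` over a map `φ : N → M`: a smooth fibrewise
linear map commuting with anchors and brackets. Since a section of `B` need not be mapped to a
section of `A`, commuting with brackets means: if `Ψ ∘ v = ∑ fᵢ (aᵢ ∘ φ)` and `Ψ ∘ w = ∑ gⱼ (bⱼ ∘ φ)`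
with `aᵢ`, `bⱼ` sections of `A`, then `Ψ ∘ [v, w]` is
`∑ fᵢ gⱼ ([aᵢ, bⱼ] ∘ φ) + ∑ ρ(v)(gⱼ) (bⱼ ∘ φ) - ∑ ρ(w)(fᵢ) (aᵢ ∘ φ)`. -/
structure Hom (B : LieAlgebroid.{u} J N) (A : LieAlgebroid.{u} I M) (φ : N → M) where
  map : ∀ y, B.Fibre y →ₗ[ℝ] A.Fibre (φ y)
  base_smooth : ContMDiff J I ∞ φ
  smooth : ContMDiff (J.prod 𝓘(ℝ, B.Model)) (I.prod 𝓘(ℝ, A.Model)) ∞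
    (fun p : TotalSpace B.Model B.Fibre => (⟨φ p.1, map p.1 p.2⟩ : TotalSpace A.Model A.Fibre))
  anchor_comm : ∀ y e, A.anchor (φ y) (map y e) = mfderiv J I φ y (B.anchor y e)
  bracket_comm : ∀ (v w : B.Sec) (p q : ℕ) (f : Fin p → C^∞⟮J, N; ℝ⟯) (a : Fin p → A.Sec)
    (g : Fin q → C^∞⟮J, N; ℝ⟯) (b : Fin q → A.Sec),
    (∀ y, map y (v y) = ∑ i, f i y • a i (φ y)) →
    (∀ y, map y (w y) = ∑ j, g j y • b j (φ y)) →
    ∀ y, map y (B.bracket v w y) =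
      ∑ i, ∑ j, (f i y * g j y) • A.bracket (a i) (b j) (φ y)
        + ∑ j, B.lieDeriv v (g j) y • b j (φ y) - ∑ i, B.lieDeriv w (f i) y • a i (φ y)

namespace Hom

variable {B : LieAlgebroid.{u} J N} {A : LieAlgebroid.{u} I M} {φ : N → M} (Ψ : Hom B A φ)

/-- A Lie algebroid submersion: a fibrewise surjective morphism over a surjective submersion. -/
structure IsSubmersion : Prop where
  base_surjective : Function.Surjective φ
  base_submersion : ∀ y, Function.Surjective (mfderiv J I φ y)
  fibre_surjective : ∀ y, Function.Surjective (Ψ.map y)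

/-- The preimage `Ψ*ξ`. -/
def pullback (ξ : A.Family) : B.Family := fun y => (ξ (φ y)).comap (Ψ.map y)

/-- The pullback `Ψ*α` of a `1`-form. -/
def pullbackOne (α : A.OneForm) : B.OneForm := fun y => α (φ y) ∘ₗ Ψ.map y

/-- The pullback `Ψ*Ω` of a bilinear form. -/
def pullbackTwo (Ω : A.BilinForm) : B.BilinForm := fun y =>
  (Ω (φ y)).compl₁₂ (Ψ.map y) (Ψ.map y)

/-- `Ψ*ξ` lifts `ξ`, that is, `Ψ` maps its fibres isomorphically onto the fibres of `ξ`. -/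
def IsLift (ξ : A.Family) (ξ' : B.Family) : Prop :=
  ∀ y, BijOn (Ψ.map y) (ξ' y) (ξ (φ y))

/-- The preimage `Ψ*ξ` is a regular distribution of the same rank as `ξ` that lifts `ξ`, and passing
to it commutes with the Lie flag and the curvatures and preserves and reflects bracket-generation
and involutivity. -/
structure LiftsRegularDistribution (ξ : A.Family) : Prop where
  lift : Ψ.IsLift ξ (Ψ.pullback ξ)
  rank_eq : ∀ k, A.IsDistribution ξ k → B.IsDistribution (Ψ.pullback ξ) k
  regular : B.IsRegular (Ψ.pullback ξ)
  /-- `Γ(Ψ*ξ)⁽ⁱ⁾ = Γ(Ψ*(ξᵢ))` -/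
  flag_sections : ∀ i, B.lieFlag (Ψ.pullback ξ) i = B.sections (Ψ.pullback (A.flagFibre ξ i))
  curvature_wellDefined : A.CurvatureWellDefined ξ ∧ B.CurvatureWellDefined (Ψ.pullback ξ)
  /-- `(Ψ*ξ)ᵢ = Ψ*(ξᵢ)`, and under the maps induced by `Ψ` the curvatures correspond:
  `Ψ(Curv_{i,j}(Ψ*ξ)(a, b)) = Curv_{i,j}(ξ)(Ψ a, Ψ b)` -/
  flag_curvature : ∃ h : ∀ i y, B.flagFibre (Ψ.pullback ξ) i y =
      (A.flagFibre ξ i (φ y)).comap (Ψ.map y),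
    ∀ i j, 1 ≤ i → 1 ≤ j → ∀ y (a : B.flagFibre (Ψ.pullback ξ) i y)
      (b : B.flagFibre (Ψ.pullback ξ) j y),
      Submodule.mapQ _ _ (Ψ.map y) (h (i + j - 1) y).le
          (B.curvature (Ψ.pullback ξ) i j y a b) =
        A.curvature ξ i j (φ y) ⟨Ψ.map y a, (h i y).le a.2⟩ ⟨Ψ.map y b, (h j y).le b.2⟩
  bracketGenerating_iff : B.IsBracketGenerating (Ψ.pullback ξ) ↔ A.IsBracketGenerating ξ
  involutive_iff : B.IsInvolutive (Ψ.pullback ξ) ↔ A.IsInvolutive ξ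

/-- `B`, with the morphism `Ψ` to `A`, is a regularisation of `A`: a foliation of codimension one,
together with a Lie algebroid submersion to `A` over the given map `φ`. -/
structure IsRegularisation : Prop where
  foliation : B.IsFoliation
  codim_one : B.rank + 1 = finrank ℝ E'
  submersion : Ψ.IsSubmersion

end Hom

end Morphisms

end LieAlgebroid

/-! ## `b^k`-tangent bundles -/

section Bk

variable {E : Type*} [NormedAddCommGroup E] [NormedSpace ℝ E]
  {H : Type*} [TopologicalSpace H] (I : ModelWithCorners ℝ E H)
  {M : Type*} [TopologicalSpace M] [ChartedSpace H M]

/-- `Z` is an embedded (closed) hypersurface: it is closed, and near each of its points it is the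
zero set of a smooth function whose differential does not vanish there. -/
def IsHypersurface (Z : Set M) : Prop :=
  IsClosed Z ∧ ∀ z ∈ Z, ∃ f : C^∞⟮I, M; ℝ⟯, mfderiv I 𝓘(ℝ, ℝ) f z ≠ 0 ∧
    ∀ᶠ y in 𝓝 z, (y ∈ Z ↔ f y = 0)

/-- The ideal `I_Z` of smooth functions that vanish on `Z`. -/
def vanishingIdeal (Z : Set M) : Ideal C^∞⟮I, M; ℝ⟯ where
  carrier := {f | ∀ z ∈ Z, f z = 0}
  add_mem' {f g} hf hg z hz := by
    change f z + g z = 0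
    rw [hf z hz, hg z hz, add_zero]
  zero_mem' _ _ := rfl
  smul_mem' c f hf z hz := by
    change c z * f z = 0
    rw [hf z hz, mul_zero]

/-- `Z` is coorientable: there is a trivialisation of its conormal bundle, given by the
differential along `Z` of a function vanishing on `Z`. -/
def IsCoorientable (Z : Set M) : Prop :=
  ∃ f ∈ vanishingIdeal I Z, ∀ z ∈ Z, mfderiv I 𝓘(ℝ, ℝ) f z ≠ 0

/-- The space `J_Z^{k-1}` of `(k-1)`-jets along `Z`, that is, smooth functions modulo `I_Z^k`. -/
abbrev JetAlong (Z : Set M) (k : ℕ) : Type _ := C^∞⟮I, M; ℝ⟯ ⧸ (vanishingIdeal I Z) ^ k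

variable {I}

/-- The jet `j ∈ J_Z^{k-1}` has vanishing zero-jet and (if `k > 1`) non-vanishing first jet. For
`k = 1` this means `j = 0`. -/
def IsAdmissibleJet {Z : Set M} {k : ℕ} (j : JetAlong I Z k) : Prop :=
  ∀ f : C^∞⟮I, M; ℝ⟯, Ideal.Quotient.mk ((vanishingIdeal I Z) ^ k) f = j →
    f ∈ vanishingIdeal I Z ∧ (2 ≤ k → ∀ z ∈ Z, mfderiv I 𝓘(ℝ, ℝ) f z ≠ 0)

/-- The vector fields `X` with `L_X f ∈ I_Z^k` for all `f` representing the jet `j`. -/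
def IsBkVectorField [IsManifold I ∞ M] {Z : Set M} {k : ℕ} (j : JetAlong I Z k)
    (X : ∀ x : M, TangentSpace I x) : Prop :=
  ContMDiff I I.tangent ∞ (fun x => (⟨x, X x⟩ : TangentBundle I M)) ∧
  ∀ f : C^∞⟮I, M; ℝ⟯, Ideal.Quotient.mk ((vanishingIdeal I Z) ^ k) f = j →
    ∃ g ∈ (vanishingIdeal I Z) ^ k, ∀ x, g x = dirDeriv I f x (X x)

/-- `A` is the `b^k`-tangent bundle determined by `Z` and the jet `j`: the Lie algebroid, of rank
`dim M`, whose sections are, via the anchor, the vector fields `X` with `L_X f ∈ I_Z^k` for all `f`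
representing `j`. This determines `A` up to unique isomorphism. -/
structure IsBkTangentBundle [IsManifold I ∞ M] {Z : Set M} {k : ℕ} (j : JetAlong I Z k)
    (A : LieAlgebroid.{u} I M) : Prop where
  rank_eq : A.rank = finrank ℝ E
  anchor_injective : ∀ v w : A.Sec, (∀ x, A.anchor x (v x) = A.anchor x (w x)) → v = w
  range_anchor : ∀ X : ∀ x : M, TangentSpace I x,
    (∃ v : A.Sec, ∀ x, A.anchor x (v x) = X x) ↔ IsBkVectorField j X

end Bk

/-- Translation of the circle factor of `M × S¹`. -/
noncomputable def circleTranslation (M : Type*) (t : Circle) (p : M × Circle) : M × Circle := (p.1, t * p.2)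

/-- Translation of the line factor of `M × ℝ`. -/
noncomputable def lineTranslation (M : Type*) (t : ℝ) (p : M × ℝ) : M × ℝ := (p.1, t + p.2)

section Coefficients

variable {E : Type*} [NormedAddCommGroup E] [NormedSpace ℝ E]
  {H : Type*} [TopologicalSpace H] {I : ModelWithCorners ℝ E H}
  {M : Type*} [TopologicalSpace M] [ChartedSpace H M]
  {E' : Type*} [NormedAddCommGroup E'] [NormedSpace ℝ E']
  {H' : Type*} [TopologicalSpace H'] {J : ModelWithCorners ℝ E' H'}
  {N : Type*} [TopologicalSpace N] [ChartedSpace H' N]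
  {ι : Type*} [Fintype ι]

theorem exists_coeff_of_mem_span {X : Type*} {V : X → Type*} [∀ y, AddCommGroup (V y)] [∀ y, Module ℝ (V y)]
    (s : ι → ∀ y, V y) (v : ∀ y, V y) : ∃ c : ι → X → ℝ,
      ∀ y, v y ∈ Submodule.span ℝ (range fun i => s i y) → v y = ∑ i, c i y • s i y := by
  have key : ∀ y, ∃ c : ι → ℝ, v y ∈ Submodule.span ℝ (range fun i => s i y) →
      v y = ∑ i, c i • s i y := by
    intro y
    by_cases h : v y ∈ Submodule.span ℝ (range fun i => s i y)
    · obtain ⟨c, hc⟩ := (Submodule.mem_span_range_iff_exists_fun ℝ).1 h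
      exact ⟨c, fun _ => hc.symm⟩
    · exact ⟨0, fun h' => absurd h' h⟩
  choose c hc using key
  exact ⟨fun i y => c y i, hc⟩

/-- The coefficients of a smooth vector-valued function with respect to smooth linearly independent
functions are smooth. -/
theorem contMDiffAt_coeff_of_sum_smul {F : Type*} [NormedAddCommGroup F] [NormedSpace ℝ F]
    [FiniteDimensional ℝ F] {σ : ι → N → F} {c : ι → N → ℝ} {y₀ : N}
    (hσ : ∀ i, ContMDiffAt J 𝓘(ℝ, F) ∞ (σ i) y₀)
    (hli : LinearIndependent ℝ (fun i => σ i y₀))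
    (hc : ContMDiffAt J 𝓘(ℝ, F) ∞ (fun y => ∑ i, c i y • σ i y) y₀) (i : ι) :
    ContMDiffAt J 𝓘(ℝ, ℝ) ∞ (c i) y₀ := by
  classical
  obtain ⟨P₀, hP₀⟩ := LinearMap.exists_leftInverse_of_injective
    (Fintype.linearCombination ℝ (fun i => σ i y₀))
    (LinearMap.ker_eq_bot.2 (linearIndependent_iff_injective_fintypeLinearCombination.1 hli))
  let P : F →L[ℝ] (ι → ℝ) := LinearMap.toContinuousLinearMap P₀
  let G : N → ((ι → ℝ) →L[ℝ] (ι → ℝ)) := fun y =>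
    ∑ i, ContinuousLinearMap.smulRightL ℝ (ι → ℝ) (ι → ℝ) (ContinuousLinearMap.proj i)
      (P (σ i y))
  have hG : ContMDiffAt J 𝓘(ℝ, (ι → ℝ) →L[ℝ] (ι → ℝ)) ∞ G y₀ := by
    refine contMDiffAt_finsetSum fun i _ => ?_
    exact (((ContinuousLinearMap.smulRightL ℝ (ι → ℝ) (ι → ℝ)
      (ContinuousLinearMap.proj i)).comp P).contMDiff.contMDiffAt).comp y₀ (hσ i)
  have hGc : ∀ y, G y (fun i => c i y) = P (∑ i, c i y • σ i y) := by
    intro y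
    simp [G, map_sum]
  have hG1 : G y₀ = 1 := by
    ext1 a
    have h := LinearMap.congr_fun hP₀ a
    simp only [LinearMap.comp_apply, Fintype.linearCombination_apply, map_sum, map_smul,
      LinearMap.id_apply] at h
    simpa [G, P] using h
  have hinv : ContMDiffAt J 𝓘(ℝ, (ι → ℝ) →L[ℝ] (ι → ℝ)) ∞ (fun y => Ring.inverse (G y)) y₀ := by
    have h : ContDiffAt ℝ ∞ Ring.inverse (G y₀) := by
      rw [hG1]
      exact contDiffAt_ringInverse ℝ (1 : ((ι → ℝ) →L[ℝ] (ι → ℝ))ˣ)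
    exact h.contMDiffAt.comp y₀ hG
  have hunit : ∀ᶠ y in 𝓝 y₀, IsUnit (G y) :=
    hG.continuousAt.eventually_mem (Units.isOpen.mem_nhds (by
      rw [mem_ofPred_eq, hG1]; exact isUnit_one))
  have hsm : ContMDiffAt J 𝓘(ℝ, ι → ℝ) ∞
      (fun y => Ring.inverse (G y) (P (∑ i, c i y • σ i y))) y₀ :=
    hinv.clm_apply (P.contMDiff.contMDiffAt.comp y₀ hc)
  refine (contMDiffAt_pi_space.1 hsm i).congr_of_eventuallyEq ?_
  filter_upwards [hunit] with y hy
  rw [← hGc, ← mul_apply_eq_comp, Ring.inverse_mul_cancel _ hy]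
  rfl

/-- The coefficients of a smooth section along a map with respect to smooth linearly independent
sections along the map are smooth. -/
theorem contMDiffAt_coeff_of_sum_smul_section
    {F : Type*} [NormedAddCommGroup F] [NormedSpace ℝ F] [FiniteDimensional ℝ F]
    {W : M → Type*} [∀ x, AddCommGroup (W x)] [∀ x, Module ℝ (W x)]
    [∀ x, TopologicalSpace (W x)] [TopologicalSpace (TotalSpace F W)] [FiberBundle F W]
    [VectorBundle ℝ F W] [IsManifold I ∞ M] [ContMDiffVectorBundle ∞ F W I]
    {φ : N → M} {s : ι → ∀ y, W (φ y)} {c : ι → N → ℝ} {y₀ : N}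
    (hs : ∀ i, ContMDiffAt J (I.prod 𝓘(ℝ, F)) ∞ (fun y => TotalSpace.mk' F (φ y) (s i y)) y₀)
    (hli : LinearIndependent ℝ (fun i => s i y₀))
    (hc : ContMDiffAt J (I.prod 𝓘(ℝ, F)) ∞
      (fun y => TotalSpace.mk' F (φ y) (∑ i, c i y • s i y)) y₀) (i : ι) :
    ContMDiffAt J 𝓘(ℝ, ℝ) ∞ (c i) y₀ := by
  let e := trivializationAt F W (φ y₀)
  have hφ : ContMDiffAt J I ∞ φ y₀ := (contMDiffAt_totalSpace.1 hc).1
  have hmem : ∀ᶠ y in 𝓝 y₀, φ y ∈ e.baseSet :=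
    hφ.continuousAt.eventually_mem (e.open_baseSet.mem_nhds (mem_baseSet_trivializationAt F W _))
  have hmem₀ : φ y₀ ∈ e.baseSet := mem_baseSet_trivializationAt F W _
  refine contMDiffAt_coeff_of_sum_smul (F := F) (σ := fun i y => (e ⟨φ y, s i y⟩).2)
    (fun i => (contMDiffAt_totalSpace.1 (hs i)).2) ?_ ?_ i
  · have := hli.map' (e.linearEquivAt ℝ _ hmem₀).toLinearMap (LinearEquiv.ker _)
    exact this
  · refine (contMDiffAt_totalSpace.1 hc).2.congr_of_eventuallyEq ?_
    filter_upwards [hmem] with y hy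
    change _ = e.linearEquivAt ℝ _ hy (∑ i, c i y • s i y)
    simp only [map_sum, map_smul]
    rfl

end Coefficients

section Cutoff

variable {E : Type*} [NormedAddCommGroup E] [NormedSpace ℝ E] [FiniteDimensional ℝ E]
  {H : Type*} [TopologicalSpace H] (I : ModelWithCorners ℝ E H)
  {M : Type*} [TopologicalSpace M] [ChartedSpace H M] [IsManifold I ∞ M] [T2Space M]

theorem exists_contMDiffMap_eventually_one_tsupport_subset {x : M} {U : Set M} (hU : U ∈ 𝓝 x) :
    ∃ χ : C^∞⟮I, M; ℝ⟯, (∀ᶠ y in 𝓝 x, χ y = 1) ∧ tsupport χ ⊆ U := by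
  obtain ⟨f, -, hf⟩ := (SmoothBumpFunction.nhds_basis_tsupport (I := I) x).mem_iff.1 hU
  exact ⟨⟨f, f.contMDiff⟩, f.eventuallyEq_one, hf⟩

variable {I}

theorem exists_contMDiffMap_eventuallyEq {c : M → ℝ} {x : M}
    (hc : ∀ᶠ y in 𝓝 x, ContMDiffAt I 𝓘(ℝ, ℝ) ∞ c y) :
    ∃ f : C^∞⟮I, M; ℝ⟯, ∀ᶠ y in 𝓝 x, f y = c y := by
  obtain ⟨χ, h1, hχ⟩ := exists_contMDiffMap_eventually_one_tsupport_subset I hc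
  refine ⟨⟨fun y => χ y • c y, fun y => ?_⟩, ?_⟩
  · by_cases hy : y ∈ tsupport χ
    · exact χ.contMDiff.contMDiffAt.smul (hχ hy)
    · refine (contMDiffAt_const (c := (0 : ℝ))).congr_of_eventuallyEq ?_
      filter_upwards [notMem_tsupport_iff_eventuallyEq.1 hy] with z hz
      simp [hz]
  · filter_upwards [h1] with y hy
    change χ y • c y = c y
    rw [hy, one_smul]

theorem exists_contMDiffSection_eventuallyEq
    {F : Type*} [NormedAddCommGroup F] [NormedSpace ℝ F]
    {V : M → Type*} [∀ x, AddCommGroup (V x)] [∀ x, Module ℝ (V x)]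
    [∀ x, TopologicalSpace (V x)] [TopologicalSpace (TotalSpace F V)] [FiberBundle F V]
    [VectorBundle ℝ F V] [ContMDiffVectorBundle ∞ F V I] {v : ∀ x, V x} {x : M}
    (hv : ∀ᶠ y in 𝓝 x, ContMDiffAt I (I.prod 𝓘(ℝ, F)) ∞ (fun z => TotalSpace.mk' F z (v z)) y) :
    ∃ w : Cₛ^∞⟮I; F, V⟯, ∀ᶠ y in 𝓝 x, w y = v y := by
  obtain ⟨χ, h1, hχ⟩ := exists_contMDiffMap_eventually_one_tsupport_subset I hv
  refine ⟨⟨fun y => χ y • v y, fun y => ?_⟩, ?_⟩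
  · by_cases hy : y ∈ tsupport χ
    · exact χ.contMDiff.contMDiffAt.smul_section (hχ hy)
    · refine ((contMDiff_zeroSection ℝ V).contMDiffAt).congr_of_eventuallyEq ?_
      filter_upwards [notMem_tsupport_iff_eventuallyEq.1 hy] with z hz
      simp [hz, zeroSection]
  · filter_upwards [h1] with y hy
    change χ y • v y = v y
    rw [hy, one_smul]

/-- There are global smooth sections that form a frame near a given point. -/
theorem exists_contMDiffSection_frame
    {F : Type*} [NormedAddCommGroup F] [NormedSpace ℝ F] [FiniteDimensional ℝ F]
    {V : M → Type*} [∀ x, AddCommGroup (V x)] [∀ x, Module ℝ (V x)]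
    [∀ x, TopologicalSpace (V x)] [TopologicalSpace (TotalSpace F V)] [FiberBundle F V]
    [VectorBundle ℝ F V] [ContMDiffVectorBundle ∞ F V I] (x : M) :
    ∃ s : Fin (finrank ℝ F) → Cₛ^∞⟮I; F, V⟯, ∀ᶠ y in 𝓝 x,
      LinearIndependent ℝ (fun i => s i y) ∧ Submodule.span ℝ (range fun i => s i y) = ⊤ := by
  let e := trivializationAt F V x
  let b := finBasis ℝ F
  have hx : x ∈ e.baseSet := mem_baseSet_trivializationAt F V x
  have hbase : ∀ᶠ y in 𝓝 x, y ∈ e.baseSet := e.open_baseSet.mem_nhds hx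
  have hloc := e.isLocalFrameOn_localFrame_baseSet I ∞ b
  choose s hs using fun i => exists_contMDiffSection_eventuallyEq (I := I) (F := F) (V := V)
    (v := e.localFrame b i) (x := x)
    (hbase.mono fun y hy => hloc.contMDiffAt e.open_baseSet hy i)
  refine ⟨s, ?_⟩
  filter_upwards [hbase, eventually_all.2 hs] with y hy hsy
  simp only [hsy]
  exact ⟨hloc.linearIndependent hy, top_le_iff.1 (hloc.generating hy)⟩

end Cutoff

namespace LieAlgebroid

section Calculus

variable {E : Type*} [NormedAddCommGroup E] [NormedSpace ℝ E]
  {H : Type*} [TopologicalSpace H] {I : ModelWithCorners ℝ E H}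
  {M : Type*} [TopologicalSpace M] [ChartedSpace H M] [IsManifold I ∞ M]
  (A : LieAlgebroid.{u} I M)

/-! ### Derivatives along sections -/

theorem lieDeriv_congr (v : A.Sec) {f g : M → ℝ} {x : M} (h : f =ᶠ[𝓝 x] g) :
    A.lieDeriv v f x = A.lieDeriv v g x := by
  unfold lieDeriv dirDeriv
  rw [h.mfderiv_eq]
  rfl

theorem lieDeriv_neg (v : A.Sec) (f : M → ℝ) (x : M) :
    A.lieDeriv v (fun y => -f y) x = -A.lieDeriv v f x := by
  change mfderiv I 𝓘(ℝ, ℝ) (-f) x _ = _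
  rw [mfderiv_neg]
  rfl

theorem lieDeriv_sum_mul {ι : Type} [Fintype ι] (v : A.Sec) {c g : ι → M → ℝ} {x : M}
    (hc : ∀ i, MDifferentiableAt I 𝓘(ℝ, ℝ) (c i) x)
    (hg : ∀ i, MDifferentiableAt I 𝓘(ℝ, ℝ) (g i) x) :
    A.lieDeriv v (fun y => ∑ i, c i y * g i y) x =
      ∑ i, (c i x * A.lieDeriv v (g i) x + A.lieDeriv v (c i) x * g i x) := by
  let D : (M → ℝ) → E →L[ℝ] ℝ := fun f => mfderiv I 𝓘(ℝ, ℝ) f x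
  have hi : ∀ i, HasMFDerivAt I 𝓘(ℝ, ℝ) (c i * g i) x (c i x • D (g i) + g i x • D (c i)) :=
    fun i => (hc i).hasMFDerivAt.mul (hg i).hasMFDerivAt
  have h := HasMFDerivAt.sum (t := (Finset.univ : Finset ι)) (f := fun i => c i * g i) (z := x)
    (f' := fun i => c i x • D (g i) + g i x • D (c i)) (fun i _ => hi i)
  have he : (fun y => ∑ i, c i y * g i y) = ∑ i, c i * g i := by
    ext y
    simp
  change mfderiv I 𝓘(ℝ, ℝ) (fun y => ∑ i, c i y * g i y) x _ = _
  rw [he, h.mfderiv]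
  have happ : ∀ X : E, (∑ i, (c i x • D (g i) + g i x • D (c i))) X =
      ∑ i, (c i x * D (g i) X + D (c i) X * g i x) := fun X => by
    simp [mul_comm]
  exact happ _

/-! ### Evaluation of sections -/

/-- Evaluation of sections at a point. -/
noncomputable def evalAt (x : M) : A.Sec →ₗ[ℝ] A.Fibre x where
  toFun v := v x
  map_add' _ _ := rfl
  map_smul' _ _ := rfl

theorem sum_smul_apply {ι : Type*} [Fintype ι] (c : ι → C^∞⟮I, M; ℝ⟯) (s : ι → A.Sec) (x : M) :
    (∑ i, c i • s i : A.Sec) x = ∑ i, c i x • s i x :=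
  map_sum (A.evalAt x) _ _

theorem lieDeriv_sum_smul {ι : Type*} [Fintype ι] {v : A.Sec} {c : ι → ℝ} {s : ι → A.Sec} {x : M}
    (h : v x = ∑ i, c i • s i x) (f : M → ℝ) :
    A.lieDeriv v f x = ∑ i, c i * A.lieDeriv (s i) f x := by
  unfold lieDeriv dirDeriv
  rw [h, map_sum]
  refine (map_sum (mfderiv I 𝓘(ℝ, ℝ) f x) _ _).trans (Finset.sum_congr rfl fun i _ => ?_)
  rw [map_smul]
  exact map_smul (mfderiv I 𝓘(ℝ, ℝ) f x) _ _

theorem sections_top : A.sections (fun _ => ⊤) = ⊤ :=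
  eq_top_iff.2 fun _ _ _ => trivial

/-! ### The bracket -/

theorem bracket_swap (v w : A.Sec) : A.bracket v w = -A.bracket w v := by
  have h := A.bracket_self (v + w)
  simp only [map_add, LinearMap.add_apply, A.bracket_self, zero_add, add_zero] at h
  exact eq_neg_of_add_eq_zero_right h

theorem bracket_swap_apply (v w : A.Sec) (x : M) : A.bracket v w x = -A.bracket w v x := by
  rw [bracket_swap]
  rfl

theorem bracket_smul_apply (v w : A.Sec) (f : C^∞⟮I, M; ℝ⟯) (x : M) :
    A.bracket v (f • w) x = f x • A.bracket v w x + A.lieDeriv v f x • w x :=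
  A.leibniz v w (f • w) f (fun _ => rfl) x

/-- A local frame of a family of subspaces near `x`, consisting of global sections. -/
def IsFrameAt {ι : Type*} (s : ι → A.Sec) (ξ : A.Family) (x : M) : Prop :=
  ∀ᶠ y in 𝓝 x, LinearIndependent ℝ (fun i => s i y) ∧
    Submodule.span ℝ (range fun i => s i y) = ξ y

variable {A}

variable (A) in
theorem isDistribution_bot : A.IsDistribution (fun _ => ⊥) 0 := fun x =>
  ⟨fun _ => 0, Eventually.of_forall fun y => ⟨linearIndependent_empty_type, by simp⟩⟩

/-! ### The Lie flag -/

theorem apply_mem_flagFibre {ξ : A.Family} {i : ℕ} {v : A.Sec} (hv : v ∈ A.lieFlag ξ i) (x : M) :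
    v x ∈ A.flagFibre ξ i x :=
  ⟨v, hv, rfl⟩

theorem le_sheafify (S : Submodule C^∞⟮I, M; ℝ⟯ A.Sec) : S ≤ A.sheafify S :=
  fun v hv _ => ⟨v, hv, Eventually.of_forall fun _ => rfl⟩

theorem lieFlag_mono (ξ : A.Family) : Monotone (A.lieFlag ξ) := by
  refine monotone_nat_of_le_succ fun i => ?_
  cases i with
  | zero => exact bot_le
  | succ i => exact le_sup_left.trans (le_sheafify _)

theorem flagFibre_mono (ξ : A.Family) (x : M) {i j : ℕ} (hij : i ≤ j) :
    A.flagFibre ξ i x ≤ A.flagFibre ξ j x := by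
  rintro _ ⟨v, hv, rfl⟩
  exact ⟨v, lieFlag_mono ξ hij hv, rfl⟩

theorem bracket_mem_lieFlag_succ {ξ : A.Family} {v w : A.Sec} {j : ℕ} (hv : v ∈ A.lieFlag ξ 1)
    (hw : w ∈ A.lieFlag ξ j) : A.bracket v w ∈ A.lieFlag ξ (j + 1) := by
  cases j with
  | zero =>
    obtain rfl : w = 0 := hw
    rw [map_zero]
    exact Submodule.zero_mem _
  | succ j =>
    exact le_sheafify _ (Submodule.mem_sup_right (Submodule.subset_span ⟨v, hv, w, hw, rfl⟩))

theorem jacobi_left (u v w : A.Sec) :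
    A.bracket (A.bracket u v) w = A.bracket u (A.bracket v w) - A.bracket v (A.bracket u w) := by
  have h := A.jacobi u v w
  rw [A.bracket_swap w u, map_neg, A.bracket_swap w (A.bracket u v)] at h
  rw [sub_eq_add_neg]
  exact (eq_of_sub_eq_zero (by rw [sub_eq_add_neg]; exact h)).symm

/-! ### The differential of a two-form -/

theorem dTwo_swap_right {Ω : A.BilinForm} (hΩ : ∀ x a b, Ω x a b = -Ω x b a) (u v w : A.Sec) (x : M) :
    A.dTwo Ω u w v x = -A.dTwo Ω u v w x := by
  unfold dTwo
  rw [A.bracket_swap_apply w v, show (fun y => Ω y (w y) (v y)) = fun y => -Ω y (v y) (w y) from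
    funext fun y => hΩ y _ _, lieDeriv_neg, map_neg, LinearMap.neg_apply]
  ring

theorem dTwo_swap_left {Ω : A.BilinForm} (hΩ : ∀ x a b, Ω x a b = -Ω x b a) (u v w : A.Sec) (x : M) :
    A.dTwo Ω v u w x = -A.dTwo Ω u v w x := by
  unfold dTwo
  rw [A.bracket_swap_apply v u, show (fun y => Ω y (v y) (u y)) = fun y => -Ω y (u y) (v y) from
    funext fun y => hΩ y _ _, lieDeriv_neg, map_neg, LinearMap.neg_apply]
  ring

variable [FiniteDimensional ℝ E] [T2Space M]

variable (A) in
theorem exists_isFrameAt_top (x : M) :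
    ∃ s : Fin A.rank → A.Sec, A.IsFrameAt s (fun _ => ⊤) x :=
  exists_contMDiffSection_frame x

/-- The bracket is local. -/
theorem bracket_congr (w : A.Sec) {v v' : A.Sec} {x : M} (h : ∀ᶠ y in 𝓝 x, v y = v' y) :
    A.bracket w v x = A.bracket w v' x := by
  obtain ⟨χ, h1, hχ⟩ := exists_contMDiffMap_eventually_one_tsupport_subset I h
  have h0 : χ • (v - v') = 0 := by
    ext y
    by_cases hy : y ∈ tsupport χ
    · have : v y = v' y := hχ hy
      change χ y • (v y - v' y) = 0
      rw [this, sub_self, smul_zero]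
    · rw [smul_apply, image_eq_zero_of_notMem_tsupport hy, zero_smul]
      rfl
  have h2 := A.bracket_smul_apply w (v - v') χ x
  have h3 : (v - v') x = 0 := sub_eq_zero.2 h.self_of_nhds
  rw [h0, h3, smul_zero, add_zero, h1.self_of_nhds, one_smul, map_zero, map_sub] at h2
  exact (sub_eq_zero.1 h2.symm)

theorem bracket_congr_left (w : A.Sec) {v v' : A.Sec} {x : M} (h : ∀ᶠ y in 𝓝 x, v y = v' y) :
    A.bracket v w x = A.bracket v' w x := by
  rw [bracket_swap_apply, bracket_congr w h, ← bracket_swap_apply]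

/-- The Leibniz rule for a section that is a combination of others near `x`. -/
theorem bracket_eq_sum {ι : Type*} [Fintype ι] (w : A.Sec) {v : A.Sec} {c : ι → C^∞⟮I, M; ℝ⟯}
    {s : ι → A.Sec} {x : M} (h : ∀ᶠ y in 𝓝 x, v y = ∑ i, c i y • s i y) :
    A.bracket w v x = ∑ i, (c i x • A.bracket w (s i) x + A.lieDeriv w (c i) x • s i x) := by
  have h' : ∀ᶠ y in 𝓝 x, v y = (∑ i, c i • s i : A.Sec) y := by
    simpa only [sum_smul_apply] using h
  rw [bracket_congr w h', map_sum]
  refine (map_sum (A.evalAt x) _ _).trans (Finset.sum_congr rfl fun i _ => ?_)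
  exact A.bracket_smul_apply w (s i) (c i) x

/-! ### Frames and distributions -/

theorem IsFrameAt.exists_coeff {ι : Type*} [Fintype ι] {s : ι → A.Sec} {ξ : A.Family} {x : M}
    (hs : A.IsFrameAt s ξ x) {v : A.Sec} (hv : ∀ᶠ y in 𝓝 x, v y ∈ ξ y) :
    ∃ c : ι → C^∞⟮I, M; ℝ⟯, ∀ᶠ y in 𝓝 x, v y = ∑ i, c i y • s i y := by
  obtain ⟨c, hc⟩ := exists_coeff_of_mem_span (fun i y => s i y) (fun y => v y)
  have hev : ∀ᶠ y in 𝓝 x, LinearIndependent ℝ (fun i => s i y) ∧ v y = ∑ i, c i y • s i y := by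
    filter_upwards [hs, hv] with y hy hvy
    exact ⟨hy.1, hc y (hy.2 ▸ hvy)⟩
  have hsm : ∀ i, ∀ᶠ y in 𝓝 x, ContMDiffAt I 𝓘(ℝ, ℝ) ∞ (c i) y := by
    intro i
    filter_upwards [hev.eventually_nhds] with y hy
    refine contMDiffAt_coeff_of_sum_smul_section (φ := fun z : M => z) (s := fun i z => s i z)
      (fun i => (s i).contMDiff.contMDiffAt) hy.self_of_nhds.1 ?_ i
    refine v.contMDiff.contMDiffAt.congr_of_eventuallyEq ?_
    filter_upwards [hy] with z hz
    rw [hz.2]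
  choose f hf using fun i => exists_contMDiffMap_eventuallyEq (hsm i)
  refine ⟨f, ?_⟩
  filter_upwards [hev, eventually_all.2 hf] with y hy hfy
  simp only [hfy, hy.2]

theorem IsDistribution.exists_frame {ξ : A.Family} {k : ℕ} (hξ : A.IsDistribution ξ k) (x : M) :
    ∃ s : Fin k → A.Sec, (∀ i, s i ∈ A.sections ξ) ∧ A.IsFrameAt s ξ x := by
  obtain ⟨s, hs⟩ := hξ x
  obtain ⟨χ, h1, hχ⟩ := exists_contMDiffMap_eventually_one_tsupport_subset I hs
  refine ⟨fun i => χ • s i, fun i y => ?_, ?_⟩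
  · by_cases hy : y ∈ tsupport χ
    · rw [smul_apply, ← (hχ hy).2]
      exact Submodule.smul_mem _ _ (Submodule.subset_span (mem_range_self i))
    · rw [smul_apply, image_eq_zero_of_notMem_tsupport hy, zero_smul]
      exact Submodule.zero_mem _
  · filter_upwards [hs, h1] with y hy hy1
    simpa only [smul_apply, hy1, one_smul] using hy

theorem IsDistribution.exists_section {ξ : A.Family} {k : ℕ} (hξ : A.IsDistribution ξ k) {x : M}
    {e : A.Fibre x} (he : e ∈ ξ x) : ∃ v ∈ A.sections ξ, v x = e := by
  obtain ⟨s, hs, hx⟩ := hξ.exists_frame x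
  rw [← hx.self_of_nhds.2] at he
  obtain ⟨c, rfl⟩ := (Submodule.mem_span_range_iff_exists_fun ℝ).1 he
  refine ⟨∑ i, (ContMDiffMap.const (c i) : C^∞⟮I, M; ℝ⟯) • s i,
    Submodule.sum_mem _ fun i _ => Submodule.smul_mem _ _ (hs i), ?_⟩
  rw [sum_smul_apply]
  rfl

variable (A) in
theorem isDistribution_top : A.IsDistribution (fun _ => ⊤) A.rank :=
  fun x => A.exists_isFrameAt_top x

theorem exists_section_apply_eq {x : M} (e : A.Fibre x) : ∃ v : A.Sec, v x = e := by
  obtain ⟨v, -, h⟩ := A.isDistribution_top.exists_section (Submodule.mem_top (x := e))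
  exact ⟨v, h⟩

theorem flagFibre_eq_of_lieFlag_eq {ξ η : A.Family} {i k : ℕ} (hη : A.IsDistribution η k)
    (h : A.lieFlag ξ i = A.sections η) : A.flagFibre ξ i = η := by
  funext x
  ext e
  constructor
  · rintro ⟨v, hv, rfl⟩
    rw [h] at hv
    exact hv x
  · intro he
    obtain ⟨v, hv, rfl⟩ := hη.exists_section he
    exact ⟨v, h ▸ hv, rfl⟩

theorem IsDistribution.flagFibre_one {ξ : A.Family} {k : ℕ} (hξ : A.IsDistribution ξ k) :
    A.flagFibre ξ 1 = ξ :=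
  flagFibre_eq_of_lieFlag_eq hξ rfl

theorem flagFibre_zero (ξ : A.Family) : A.flagFibre ξ 0 = fun _ => ⊥ := by
  refine flagFibre_eq_of_lieFlag_eq A.isDistribution_bot ?_
  ext v
  constructor
  · rintro (rfl : v = 0)
    exact Submodule.zero_mem _
  · intro hv
    change v = 0
    ext x
    exact hv x

/-! ### Regular distributions and curvature -/

/-- All terms of the Lie flag consist of the sections of a distribution. -/
theorem IsRegular.exists_isDistribution_flagFibre {ξ : A.Family} (hξ : A.IsRegular ξ) (i : ℕ) :
    (∃ k, A.IsDistribution (A.flagFibre ξ i) k) ∧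
      A.lieFlag ξ i = A.sections (A.flagFibre ξ i) := by
  obtain rfl | hi := Nat.eq_zero_or_pos i
  · rw [flagFibre_zero]
    refine ⟨⟨0, A.isDistribution_bot⟩, ?_⟩
    ext v
    exact ⟨fun h x => by rw [show v = 0 from h]; rfl, fun h => by ext x; exact h x⟩
  · obtain ⟨η, k, hη, h⟩ := hξ.2 i hi
    rw [flagFibre_eq_of_lieFlag_eq hη h.symm]
    exact ⟨⟨k, hη⟩, h.symm⟩

theorem bracket_mem_lieFlag_add {ξ : A.Family}
    (h : ∀ i, A.lieFlag ξ i = A.sections (A.flagFibre ξ i)) (i : ℕ) :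
    ∀ (j : ℕ) {v w : A.Sec}, v ∈ A.lieFlag ξ i → w ∈ A.lieFlag ξ j →
      A.bracket v w ∈ A.lieFlag ξ (i + j) := by
  induction i using Nat.twoStepInduction with
  | zero =>
    rintro j v w (rfl : v = 0) -
    rw [map_zero, LinearMap.zero_apply]
    exact Submodule.zero_mem _
  | one =>
    intro j v w hv hw
    rw [add_comm]
    exact bracket_mem_lieFlag_succ hv hw
  | more i _ ih =>
    intro j u z hu hz
    rw [h]
    intro x
    obtain ⟨u', hu', hx⟩ := hu x
    rw [bracket_congr_left z hx]
    obtain ⟨a, ha, b, hb, rfl⟩ := Submodule.mem_sup.1 hu'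
    rw [map_add, LinearMap.add_apply]
    refine Submodule.add_mem _ (apply_mem_flagFibre
      (lieFlag_mono ξ (by omega) (ih j ha hz)) x) ?_
    have hle : ∀ {b : A.Sec}, b ∈ Submodule.span C^∞⟮I, M; ℝ⟯
        {u | ∃ v ∈ A.sections ξ, ∃ w ∈ A.lieFlag ξ (i + 1), u = A.bracket v w} →
        b ∈ A.lieFlag ξ (i + 2 + j) := fun hb =>
      lieFlag_mono ξ (by omega) (show _ ∈ A.lieFlag ξ (i + 2) from
        le_sheafify _ (Submodule.mem_sup_right hb))
    clear hu' hx
    induction hb using Submodule.span_induction with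
    | mem b hb =>
      obtain ⟨v, hv, w, hw, rfl⟩ := hb
      refine apply_mem_flagFibre ?_ x
      rw [jacobi_left]
      refine Submodule.sub_mem _ ?_ ?_
      · exact lieFlag_mono ξ (by omega) (bracket_mem_lieFlag_succ hv (ih j hw hz))
      · exact lieFlag_mono ξ (by omega) (ih (j + 1) hw (bracket_mem_lieFlag_succ hv hz))
    | zero =>
      rw [map_zero, LinearMap.zero_apply]
      exact Submodule.zero_mem _
    | add b b' _ _ hb hb' =>
      rw [map_add, LinearMap.add_apply]
      exact Submodule.add_mem _ hb hb'
    | smul f b hb hbz =>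
      rw [bracket_swap_apply, bracket_smul_apply, neg_add, ← smul_neg, ← bracket_swap_apply]
      exact Submodule.add_mem _ (Submodule.smul_mem _ _ hbz) (Submodule.neg_mem _
        (Submodule.smul_mem _ _ (apply_mem_flagFibre (hle hb) x)))

theorem bracket_apply_mem_of_apply_eq_zero {ξ : A.Family} {k : ℕ} (hξ : A.IsDistribution ξ k)
    {P : ∀ x, Submodule ℝ (A.Fibre x)} (hP : ∀ x, ξ x ≤ P x) {v w : A.Sec} {x : M}
    (hv : v ∈ A.sections ξ) (hx : v x = 0) : A.bracket w v x ∈ P x := by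
  obtain ⟨s, hs, hsx⟩ := hξ.exists_frame x
  obtain ⟨c, hc⟩ := hsx.exists_coeff (Eventually.of_forall hv)
  have h0 : ∀ i, c i x = 0 := by
    have := hc.self_of_nhds
    rw [hx] at this
    exact Fintype.linearIndependent_iff.1 hsx.self_of_nhds.1 _ this.symm
  rw [bracket_eq_sum w hc]
  refine Submodule.sum_mem _ fun i _ => ?_
  rw [h0, zero_smul, zero_add]
  exact Submodule.smul_mem _ _ (hP x (hs i x))

/-- Independence of the curvature of the chosen sections. -/
theorem curvature_apply {ξ : A.Family} {i j : ℕ} (hi : 1 ≤ i) (hj : 1 ≤ j)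
    {p q : ℕ} (hpi : A.IsDistribution (A.flagFibre ξ i) p)
    (hqj : A.IsDistribution (A.flagFibre ξ j) q)
    {v w : A.Sec} (hv : v ∈ A.lieFlag ξ i) (hw : w ∈ A.lieFlag ξ j) {x : M}
    {a : A.flagFibre ξ i x} {b : A.flagFibre ξ j x} (ha : v x = a) (hb : w x = b) :
    A.curvature ξ i j x a b = Submodule.Quotient.mk (A.bracket v w x) := by
  unfold curvature
  obtain ⟨hv', ha'⟩ := a.2.choose_spec
  obtain ⟨hw', hb'⟩ := b.2.choose_spec
  set v' := a.2.choose
  set w' := b.2.choose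
  rw [Submodule.Quotient.eq]
  have h1 : A.bracket v' w' x - A.bracket v w x
      = A.bracket v' (w' - w) x - A.bracket w (v' - v) x := by
    rw [map_sub, map_sub]
    change _ = (A.bracket v' w' x - A.bracket v' w x) - (A.bracket w v' x - A.bracket w v x)
    rw [A.bracket_swap_apply w v', A.bracket_swap_apply w v]
    abel
  rw [h1]
  refine Submodule.sub_mem _ ?_ ?_
  · refine bracket_apply_mem_of_apply_eq_zero (P := A.flagFibre ξ (i + j - 1)) hqj
      (fun y => flagFibre_mono ξ y (by omega))
      (fun y => apply_mem_flagFibre (Submodule.sub_mem _ hw' hw) y) ?_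
    change w' x - w x = 0
    rw [hb', hb, sub_self]
  · refine bracket_apply_mem_of_apply_eq_zero (P := A.flagFibre ξ (i + j - 1)) hpi
      (fun y => flagFibre_mono ξ y (by omega))
      (fun y => apply_mem_flagFibre (Submodule.sub_mem _ hv' hv) y) ?_
    change v' x - v x = 0
    rw [ha', ha, sub_self]

theorem IsRegular.curvatureWellDefined {ξ : A.Family} (hξ : A.IsRegular ξ) :
    A.CurvatureWellDefined ξ := by
  intro i j hi hj v w hv hw
  obtain ⟨p, hp⟩ := (hξ.exists_isDistribution_flagFibre i).1
  obtain ⟨q, hq⟩ := (hξ.exists_isDistribution_flagFibre j).1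
  exact ⟨bracket_mem_lieFlag_add (fun i => (hξ.exists_isDistribution_flagFibre i).2) i j hv hw,
    fun x => curvature_apply hi hj hp hq hv hw rfl rfl⟩

/-! ### The differential of a two-form is tensorial -/

section TwoForm

variable {Ω : A.BilinForm}

theorem dTwo_eq_sum {ι : Type} [Fintype ι] (hΩ : ∀ x a b, Ω x a b = -Ω x b a)
    (hsm : ∀ v w : A.Sec, ContMDiff I 𝓘(ℝ, ℝ) ∞ (fun x => Ω x (v x) (w x)))
    (u v : A.Sec) {w : A.Sec} {c : ι → C^∞⟮I, M; ℝ⟯} {s : ι → A.Sec} {x : M}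
    (h : ∀ᶠ y in 𝓝 x, w y = ∑ i, c i y • s i y) :
    A.dTwo Ω u v w x = ∑ i, c i x * A.dTwo Ω u v (s i) x := by
  have hd : ∀ u v : A.Sec, A.lieDeriv u (fun y => Ω y (v y) (w y)) x =
      ∑ i, (c i x * A.lieDeriv u (fun y => Ω y (v y) (s i y)) x
        + A.lieDeriv u (c i) x * Ω x (v x) (s i x)) := by
    intro u v
    rw [← A.lieDeriv_sum_mul u (fun i => (c i).mdifferentiableAt)
      (fun i => (hsm v (s i)).mdifferentiable (by simp) x)]
    refine A.lieDeriv_congr u ?_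
    filter_upwards [h] with y hy
    simp only [hy, map_sum, map_smul, smul_eq_mul]
  have hb : ∀ u v : A.Sec, Ω x (A.bracket u w x) (v x) =
      ∑ i, (c i x * Ω x (A.bracket u (s i) x) (v x) - A.lieDeriv u (c i) x * Ω x (v x) (s i x)) := by
    intro u v
    rw [bracket_eq_sum u h, map_sum, LinearMap.sum_apply]
    refine Finset.sum_congr rfl fun i _ => ?_
    rw [hΩ x (v x) (s i x)]
    simp
  unfold dTwo
  rw [hd u v, hd v u, hb u v, hb v u, A.lieDeriv_sum_smul h.self_of_nhds]
  have hl : Ω x (A.bracket u v x) (w x) = ∑ i, c i x * Ω x (A.bracket u v x) (s i x) := by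
    rw [h.self_of_nhds]
    simp
  rw [hl]
  simp only [← Finset.sum_add_distrib, ← Finset.sum_sub_distrib]
  exact Finset.sum_congr rfl fun i _ => by ring

/-- A two-form is closed if its differential vanishes on the members of local frames. -/
theorem dTwo_eq_zero_of_frame (hΩ : ∀ x a b, Ω x a b = -Ω x b a)
    (hsm : ∀ v w : A.Sec, ContMDiff I 𝓘(ℝ, ℝ) ∞ (fun x => Ω x (v x) (w x)))
    {ι : Type} [Fintype ι] {s : ι → A.Sec} {x : M} (hs : A.IsFrameAt s (fun _ => ⊤) x)
    (h0 : ∀ i j k, A.dTwo Ω (s i) (s j) (s k) x = 0) (u v w : A.Sec) : A.dTwo Ω u v w x = 0 := by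
  have key : ∀ u v : A.Sec, (∀ k, A.dTwo Ω u v (s k) x = 0) → ∀ w, A.dTwo Ω u v w x = 0 := by
    intro u v h w
    obtain ⟨c, hc⟩ := hs.exists_coeff (v := w) (Eventually.of_forall fun _ => trivial)
    rw [dTwo_eq_sum hΩ hsm u v hc]
    simp [h]
  have h1 : ∀ i j w, A.dTwo Ω (s i) (s j) w x = 0 := fun i j => key _ _ (h0 i j)
  have h2 : ∀ i v w, A.dTwo Ω (s i) v w x = 0 := fun i v w => key _ _ (fun k => by
    rw [dTwo_swap_right hΩ, h1, neg_zero]) w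
  exact key _ _ (fun k => by
    rw [dTwo_swap_right hΩ, dTwo_swap_left hΩ, h2, neg_zero, neg_zero]) w

end TwoForm

end Calculus

end LieAlgebroid

namespace LieAlgebroid

section FibreRank

variable {E : Type*} [NormedAddCommGroup E] [NormedSpace ℝ E]
  {H : Type*} [TopologicalSpace H] {I : ModelWithCorners ℝ E H}
  {M : Type*} [TopologicalSpace M] [ChartedSpace H M] [IsManifold I ∞ M]
  (A : LieAlgebroid.{u} I M)

/-- The fibres of a Lie algebroid are isomorphic to the model fibre. -/
noncomputable def fibreEquiv (x : M) : A.Fibre x ≃ₗ[ℝ] A.Model :=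
  (trivializationAt A.Model A.Fibre x).linearEquivAt ℝ x (mem_baseSet_trivializationAt _ _ x)

theorem finiteDimensional_fibre (x : M) : FiniteDimensional ℝ (A.Fibre x) :=
  Module.Finite.equiv (A.fibreEquiv x).symm

theorem finrank_fibre (x : M) : finrank ℝ (A.Fibre x) = A.rank :=
  (A.fibreEquiv x).finrank_eq

end FibreRank

namespace Hom

variable {E : Type*} [NormedAddCommGroup E] [NormedSpace ℝ E]
  {H : Type*} [TopologicalSpace H] {I : ModelWithCorners ℝ E H}
  {M : Type*} [TopologicalSpace M] [ChartedSpace H M] [IsManifold I ∞ M]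
  {E' : Type*} [NormedAddCommGroup E'] [NormedSpace ℝ E']
  {H' : Type*} [TopologicalSpace H'] {J : ModelWithCorners ℝ E' H'}
  {N : Type*} [TopologicalSpace N] [ChartedSpace H' N] [IsManifold J ∞ N]
  {B : LieAlgebroid.{u} J N} {A : LieAlgebroid.{u} I M} {φ : N → M} (Ψ : Hom B A φ)

/-- A morphism that is an isomorphism on each fibre. -/
def IsFibrewiseIso : Prop := ∀ y, Function.Bijective (Ψ.map y)

variable {Ψ}

theorem IsSubmersion.isFibrewiseIso (h : Ψ.IsSubmersion) (hr : B.rank = A.rank) :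
    Ψ.IsFibrewiseIso := fun y => by
  have := B.finiteDimensional_fibre y
  have := A.finiteDimensional_fibre (φ y)
  refine ⟨(LinearMap.injective_iff_surjective_of_finrank_eq_finrank ?_).2 (h.fibre_surjective y),
    h.fibre_surjective y⟩
  rw [finrank_fibre, finrank_fibre, hr]

theorem isLift_pullback (hΨ : Ψ.IsFibrewiseIso) (ξ : A.Family) : Ψ.IsLift ξ (Ψ.pullback ξ) := fun y =>
  ⟨fun _ h => h, (hΨ y).1.injOn, fun e he => by
    obtain ⟨e, rfl⟩ := (hΨ y).2 e
    exact ⟨e, he, rfl⟩⟩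

variable [FiniteDimensional ℝ E'] [T2Space N]

/-- A section of `B` whose image under a fibrewise injective morphism is smooth is smooth. -/
theorem contMDiff_of_map (hΨ : ∀ y, Function.Injective (Ψ.map y)) {v : ∀ y, B.Fibre y}
    (hv : ContMDiff J (I.prod 𝓘(ℝ, A.Model)) ∞
      (fun y => TotalSpace.mk' A.Model (φ y) (Ψ.map y (v y)))) :
    ContMDiff J (J.prod 𝓘(ℝ, B.Model)) ∞ (fun y => TotalSpace.mk' B.Model y (v y)) := by
  intro y₀
  obtain ⟨s, hs⟩ := B.exists_isFrameAt_top y₀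
  obtain ⟨c, hc⟩ := exists_coeff_of_mem_span (fun i y => s i y) v
  have hev : ∀ᶠ y in 𝓝 y₀, v y = ∑ i, c i y • s i y :=
    hs.mono fun y hy => hc y (hy.2 ▸ Submodule.mem_top)
  have hcs : ∀ i, ContMDiffAt J 𝓘(ℝ, ℝ) ∞ (c i) y₀ := by
    refine contMDiffAt_coeff_of_sum_smul_section (φ := φ) (s := fun i y => Ψ.map y (s i y))
      (fun i => (Ψ.smooth.comp (s i).contMDiff).contMDiffAt)
      (hs.self_of_nhds.1.map' _ (LinearMap.ker_eq_bot.2 (hΨ y₀))) ?_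
    refine hv.contMDiffAt.congr_of_eventuallyEq ?_
    filter_upwards [hev] with y hy
    rw [hy]
    simp
  refine (ContMDiffAt.sum_section (s := Finset.univ) (t := fun i y => c i y • s i y)
    fun i _ => (hcs i).smul_section (s i).contMDiff.contMDiffAt).congr_of_eventuallyEq ?_
  filter_upwards [hev] with y hy
  rw [hy]

/-- The section of `B` that is mapped to a given section of `A`. -/
noncomputable def lift (hΨ : Ψ.IsFibrewiseIso) (v : A.Sec) : B.Sec :=
  ⟨fun y => (LinearEquiv.ofBijective (Ψ.map y) (hΨ y)).symm (v (φ y)),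
    contMDiff_of_map (fun y => (hΨ y).1) <| by
      have h : ∀ y, Ψ.map y ((LinearEquiv.ofBijective (Ψ.map y) (hΨ y)).symm (v (φ y))) =
          v (φ y) := fun y => (LinearEquiv.ofBijective (Ψ.map y) (hΨ y)).apply_symm_apply _
      simp only [h]
      exact v.contMDiff.comp Ψ.base_smooth⟩

variable (hΨ : Ψ.IsFibrewiseIso)
include hΨ

theorem map_lift (v : A.Sec) (y : N) : Ψ.map y (lift hΨ v y) = v (φ y) :=
  (LinearEquiv.ofBijective (Ψ.map y) (hΨ y)).apply_symm_apply (v (φ y))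

theorem lift_eq_of_map {v : A.Sec} {y : N} {e : B.Fibre y} (h : Ψ.map y e = v (φ y)) :
    lift hΨ v y = e :=
  (hΨ y).1 (by rw [map_lift, h])

theorem lift_add (v w : A.Sec) : lift hΨ (v + w) = lift hΨ v + lift hΨ w := by
  ext y
  refine lift_eq_of_map hΨ ?_
  change Ψ.map y (lift hΨ v y + lift hΨ w y) = v (φ y) + w (φ y)
  rw [map_add, map_lift, map_lift]

theorem lift_smul (f : C^∞⟮I, M; ℝ⟯) (v : A.Sec) :
    lift hΨ (f • v) = f.comp (⟨φ, Ψ.base_smooth⟩ : C^∞⟮J, N; I, M⟯) • lift hΨ v := by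
  ext y
  refine lift_eq_of_map hΨ ?_
  rw [smul_apply, map_smul, map_lift]
  rfl

theorem lift_zero : lift hΨ (0 : A.Sec) = 0 := by
  ext y
  exact lift_eq_of_map hΨ (map_zero _)

theorem bracket_lift (v w : A.Sec) :
    B.bracket (lift hΨ v) (lift hΨ w) = lift hΨ (A.bracket v w) := by
  ext y
  symm
  refine lift_eq_of_map hΨ ?_
  have h := Ψ.bracket_comm (lift hΨ v) (lift hΨ w) 1 1 (fun _ => 1) (fun _ => v) (fun _ => 1)
    (fun _ => w) (fun y => by simp [map_lift hΨ]) (fun y => by simp [map_lift hΨ]) y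
  have h1 : ∀ u : B.Sec, B.lieDeriv u (1 : C^∞⟮J, N; ℝ⟯) y = 0 := by
    intro u
    change mfderiv J 𝓘(ℝ, ℝ) (fun _ => (1 : ℝ)) y _ = 0
    rw [mfderiv_const]
    rfl
  rw [h, Fin.sum_univ_one, Fin.sum_univ_one, Fin.sum_univ_one, Fin.sum_univ_one, h1, h1]
  simp

theorem lieDeriv_lift (v : A.Sec) {f : M → ℝ} (hf : ContMDiff I 𝓘(ℝ, ℝ) ∞ f) (y : N) :
    B.lieDeriv (lift hΨ v) (fun z => f (φ z)) y = A.lieDeriv v f (φ y) := by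
  have hφ : MDifferentiableAt J I φ y := Ψ.base_smooth.mdifferentiable (by simp) y
  have hf' : MDifferentiableAt I 𝓘(ℝ, ℝ) f (φ y) := hf.mdifferentiable (by simp) _
  have hc : mfderiv J 𝓘(ℝ, ℝ) (fun z => f (φ z)) y =
      (mfderiv I 𝓘(ℝ, ℝ) f (φ y)).comp (mfderiv J I φ y) := mfderiv_comp y hf' hφ
  unfold lieDeriv dirDeriv
  rw [hc, ← map_lift hΨ v y, Ψ.anchor_comm]
  rfl

/-! ### Pullbacks of distributions -/

theorem isFrameAt_lift {ι : Type*} {s : ι → A.Sec} {ξ : A.Family} {y : N}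
    (hs : A.IsFrameAt s ξ (φ y)) :
    B.IsFrameAt (fun i => lift hΨ (s i)) (Ψ.pullback ξ) y := by
  filter_upwards [Ψ.base_smooth.continuous.continuousAt.eventually hs] with z hz
  have hcomp : (fun i => s i (φ z)) = Ψ.map z ∘ fun i => lift hΨ (s i) z :=
    funext fun i => (map_lift hΨ _ _).symm
  rw [hcomp] at hz
  refine ⟨LinearIndependent.of_comp _ hz.1, ?_⟩
  rw [pullback, ← hz.2, range_comp, ← Submodule.map_span,
    Submodule.comap_map_eq_of_injective (hΨ z).1]

theorem isDistribution_pullback {ξ : A.Family} {k : ℕ} (hξ : A.IsDistribution ξ k) :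
    B.IsDistribution (Ψ.pullback ξ) k := fun y => by
  obtain ⟨s, hs⟩ := hξ (φ y)
  exact ⟨_, isFrameAt_lift hΨ hs⟩

theorem lift_mem_sections {ξ : A.Family} {v : A.Sec} (hv : v ∈ A.sections ξ) :
    lift hΨ v ∈ B.sections (Ψ.pullback ξ) := fun y => by
  change Ψ.map y _ ∈ ξ (φ y)
  rw [map_lift]
  exact hv _

variable [FiniteDimensional ℝ E] [T2Space M]

/-- Brackets of sections of pullbacks are determined by brackets of sections downstairs. -/
theorem bracket_mem_sections_pullback {ξ η ζ : A.Family} {k l : ℕ} (hξ : A.IsDistribution ξ k)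
    (hη : A.IsDistribution η l) (hξζ : ∀ x, ξ x ≤ ζ x) (hηζ : ∀ x, η x ≤ ζ x)
    (h : ∀ v ∈ A.sections ξ, ∀ w ∈ A.sections η, A.bracket v w ∈ A.sections ζ) {v w : B.Sec}
    (hv : v ∈ B.sections (Ψ.pullback ξ)) (hw : w ∈ B.sections (Ψ.pullback η)) :
    B.bracket v w ∈ B.sections (Ψ.pullback ζ) := by
  intro y
  obtain ⟨s, hs, hsy⟩ := hξ.exists_frame (φ y)
  obtain ⟨t, ht, hty⟩ := hη.exists_frame (φ y)
  obtain ⟨c, hc⟩ := (isFrameAt_lift hΨ hsy).exists_coeff (Eventually.of_forall hv)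
  obtain ⟨d, hd⟩ := (isFrameAt_lift hΨ hty).exists_coeff (Eventually.of_forall hw)
  have hsζ : ∀ i, lift hΨ (s i) y ∈ Ψ.pullback ζ y := fun i =>
    lift_mem_sections hΨ (fun x => hξζ x (hs i x)) y
  have htζ : ∀ i, lift hΨ (t i) y ∈ Ψ.pullback ζ y := fun i =>
    lift_mem_sections hΨ (fun x => hηζ x (ht i x)) y
  rw [bracket_eq_sum v hd]
  refine Submodule.sum_mem _ fun j _ =>
    Submodule.add_mem _ (Submodule.smul_mem _ _ ?_) (Submodule.smul_mem _ _ (htζ j))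
  rw [bracket_swap_apply, bracket_eq_sum _ hc]
  refine Submodule.neg_mem _ (Submodule.sum_mem _ fun i _ =>
    Submodule.add_mem _ (Submodule.smul_mem _ _ ?_) (Submodule.smul_mem _ _ (hsζ i)))
  rw [bracket_swap_apply, bracket_lift]
  exact Submodule.neg_mem _ (lift_mem_sections hΨ (h _ (hs i) _ (ht j)) y)

/-- Passing to the Lie flag commutes with pullbacks. -/
theorem lieFlag_pullback {ξ : A.Family} (hξ : A.IsRegular ξ) (i : ℕ) :
    B.lieFlag (Ψ.pullback ξ) i = B.sections (Ψ.pullback (A.flagFibre ξ i)) := by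
  have hL := fun i => (hξ.exists_isDistribution_flagFibre i).2
  obtain ⟨k, hk⟩ := hξ.1
  induction i using Nat.twoStepInduction with
  | zero =>
    rw [flagFibre_zero]
    ext v
    refine ⟨fun h y => ?_, fun h => ?_⟩
    · rw [show v = 0 from h]
      exact Submodule.zero_mem _
    · change v = 0
      ext y
      exact (hΨ y).1 ((h y).trans (map_zero _).symm)
  | one =>
    rw [hk.flagFibre_one]
    rfl
  | more i _ ih =>
    obtain ⟨p, hp⟩ := (hξ.exists_isDistribution_flagFibre (i + 1)).1
    obtain ⟨q, hq⟩ := (hξ.exists_isDistribution_flagFibre (i + 2)).1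
    apply le_antisymm
    · have hle : B.lieFlag (Ψ.pullback ξ) (i + 1) ⊔ Submodule.span C^∞⟮J, N; ℝ⟯
          {u | ∃ v ∈ B.sections (Ψ.pullback ξ), ∃ w ∈ B.lieFlag (Ψ.pullback ξ) (i + 1),
            u = B.bracket v w} ≤ B.sections (Ψ.pullback (A.flagFibre ξ (i + 2))) := by
        refine sup_le ?_ (Submodule.span_le.2 ?_)
        · rw [ih]
          exact fun v hv y => flagFibre_mono ξ _ (by omega) (hv y)
        · rintro _ ⟨v, hv, w, hw, rfl⟩
          rw [ih] at hw
          refine bracket_mem_sections_pullback hΨ hk hp (fun x => ?_)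
            (fun x => flagFibre_mono ξ x (by omega)) ?_ hv hw
          · have := flagFibre_mono ξ x (show 1 ≤ i + 2 by omega)
            rwa [hk.flagFibre_one] at this
          · intro v hv w hw
            rw [← hL] at hw ⊢
            exact bracket_mem_lieFlag_succ hv hw
      intro u hu y
      obtain ⟨u', hu', hy⟩ := hu y
      rw [hy.self_of_nhds]
      exact hle hu' y
    · have hlift : ∀ {w : A.Sec}, w ∈ A.lieFlag ξ (i + 1) ⊔ Submodule.span C^∞⟮I, M; ℝ⟯
          {u | ∃ v ∈ A.sections ξ, ∃ w ∈ A.lieFlag ξ (i + 1), u = A.bracket v w} →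
          lift hΨ w ∈ B.lieFlag (Ψ.pullback ξ) (i + 1) ⊔ Submodule.span C^∞⟮J, N; ℝ⟯
          {u | ∃ v ∈ B.sections (Ψ.pullback ξ), ∃ w ∈ B.lieFlag (Ψ.pullback ξ) (i + 1),
            u = B.bracket v w} := by
        have h1 : ∀ {w : A.Sec}, w ∈ A.lieFlag ξ (i + 1) →
            lift hΨ w ∈ B.lieFlag (Ψ.pullback ξ) (i + 1) := fun hw => by
          rw [ih]
          rw [hL] at hw
          exact lift_mem_sections hΨ hw
        intro w hw
        obtain ⟨a, ha, b, hb, rfl⟩ := Submodule.mem_sup.1 hw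
        clear hw
        rw [lift_add]
        refine Submodule.add_mem _ (Submodule.mem_sup_left (h1 ha)) (Submodule.mem_sup_right ?_)
        induction hb using Submodule.span_induction with
        | mem b hb =>
          obtain ⟨v, hv, w, hw, rfl⟩ := hb
          rw [← bracket_lift]
          exact Submodule.subset_span ⟨_, lift_mem_sections hΨ hv, _, h1 hw, rfl⟩
        | zero =>
          rw [lift_zero]
          exact Submodule.zero_mem _
        | add b b' _ _ hb hb' =>
          rw [lift_add]
          exact Submodule.add_mem _ hb hb'
        | smul f b _ hb =>
          rw [lift_smul]
          exact Submodule.smul_mem _ _ hb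
      intro u hu y
      obtain ⟨s, hs, hsy⟩ := hq.exists_frame (φ y)
      obtain ⟨c, hc⟩ := (isFrameAt_lift hΨ hsy).exists_coeff (Eventually.of_forall hu)
      rw [← hL] at hs
      choose w hw hsw using fun a => hs a (φ y)
      refine ⟨∑ a, c a • lift hΨ (w a), Submodule.sum_mem _ fun a _ =>
        Submodule.smul_mem _ _ (hlift (hw a)), ?_⟩
      filter_upwards [hc, eventually_all.2 fun a =>
        Ψ.base_smooth.continuous.continuousAt.eventually (hsw a)] with z hz hsz
      rw [hz, sum_smul_apply]
      refine Finset.sum_congr rfl fun a _ => ?_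
      rw [lift_eq_of_map hΨ ((map_lift hΨ (w a) z).trans (hsz a).symm)]

theorem flagFibre_pullback {ξ : A.Family} (hξ : A.IsRegular ξ) (i : ℕ) :
    B.flagFibre (Ψ.pullback ξ) i = Ψ.pullback (A.flagFibre ξ i) := by
  obtain ⟨k, hk⟩ := (hξ.exists_isDistribution_flagFibre i).1
  exact flagFibre_eq_of_lieFlag_eq (isDistribution_pullback hΨ hk) (lieFlag_pullback hΨ hξ i)

theorem mapQ_curvature_pullback {ξ : A.Family} {i j p q : ℕ} (hi : 1 ≤ i) (hj : 1 ≤ j)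
    (hp : A.IsDistribution (A.flagFibre ξ i) p) (hq : A.IsDistribution (A.flagFibre ξ j) q)
    (hAi : A.lieFlag ξ i = A.sections (A.flagFibre ξ i))
    (hAj : A.lieFlag ξ j = A.sections (A.flagFibre ξ j))
    (hBi : B.lieFlag (Ψ.pullback ξ) i = B.sections (Ψ.pullback (A.flagFibre ξ i)))
    (hBj : B.lieFlag (Ψ.pullback ξ) j = B.sections (Ψ.pullback (A.flagFibre ξ j))) {y : N}
    (hle : B.flagFibre (Ψ.pullback ξ) (i + j - 1) y ≤
      (A.flagFibre ξ (i + j - 1) (φ y)).comap (Ψ.map y))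
    (a : B.flagFibre (Ψ.pullback ξ) i y) (b : B.flagFibre (Ψ.pullback ξ) j y)
    (ha : Ψ.map y a ∈ A.flagFibre ξ i (φ y)) (hb : Ψ.map y b ∈ A.flagFibre ξ j (φ y)) :
    Submodule.mapQ _ _ (Ψ.map y) hle (B.curvature (Ψ.pullback ξ) i j y a b) =
      A.curvature ξ i j (φ y) ⟨Ψ.map y a, ha⟩ ⟨Ψ.map y b, hb⟩ := by
  obtain ⟨v, hv, hva⟩ := hp.exists_section ha
  obtain ⟨w, hw, hwb⟩ := hq.exists_section hb
  have hBp := isDistribution_pullback hΨ hp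
  have hBq := isDistribution_pullback hΨ hq
  rw [← flagFibre_eq_of_lieFlag_eq hBp hBi] at hBp
  rw [← flagFibre_eq_of_lieFlag_eq hBq hBj] at hBq
  rw [curvature_apply hi hj hBp hBq (hBi ▸ lift_mem_sections hΨ hv)
    (hBj ▸ lift_mem_sections hΨ hw) (lift_eq_of_map hΨ hva.symm) (lift_eq_of_map hΨ hwb.symm),
    curvature_apply hi hj hp hq (hAi ▸ hv) (hAj ▸ hw) hva hwb, bracket_lift, Submodule.mapQ_apply,
    map_lift]

theorem sections_pullback_eq_iff (hφ : Function.Surjective φ) {η : A.Family} {k : ℕ}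
    (hη : A.IsDistribution η k) {ζ : A.Family} {l : ℕ} (hζ : A.IsDistribution ζ l) :
    B.sections (Ψ.pullback η) = B.sections (Ψ.pullback ζ) ↔ A.sections η = A.sections ζ := by
  have fibres : ∀ {η ζ : A.Family} {k : ℕ}, A.IsDistribution η k →
      B.sections (Ψ.pullback η) ≤ B.sections (Ψ.pullback ζ) →
      A.sections η ≤ A.sections ζ := fun hη h v hv x => by
    obtain ⟨y, rfl⟩ := hφ x
    have := h (lift_mem_sections hΨ hv) y
    rwa [pullback, Submodule.mem_comap, map_lift] at this
  have fibres' : ∀ {η ζ : A.Family} {k : ℕ}, A.IsDistribution η k →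
      A.sections η ≤ A.sections ζ →
      B.sections (Ψ.pullback η) ≤ B.sections (Ψ.pullback ζ) := fun hη h v hv y => by
    obtain ⟨w, hw, hwy⟩ := hη.exists_section (hv y)
    rw [pullback, Submodule.mem_comap]
    rw [← hwy]
    exact h hw _
  exact ⟨fun h => le_antisymm (fibres hη h.le) (fibres hζ h.ge),
    fun h => le_antisymm (fibres' hη h.le) (fibres' hζ h.ge)⟩

theorem liftsRegularDistribution (hφ : Function.Surjective φ) {ξ : A.Family}
    (hξ : A.IsRegular ξ) : Ψ.LiftsRegularDistribution ξ := by
  have hD := fun i => (hξ.exists_isDistribution_flagFibre i).1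
  have hL := fun i => (hξ.exists_isDistribution_flagFibre i).2
  have hreg : B.IsRegular (Ψ.pullback ξ) :=
    ⟨hξ.1.imp fun k => isDistribution_pullback hΨ, fun i _ => ⟨Ψ.pullback (A.flagFibre ξ i),
      (hD i).imp fun k hk => ⟨isDistribution_pullback hΨ hk, (lieFlag_pullback hΨ hξ i).symm⟩⟩⟩
  refine ⟨isLift_pullback hΨ ξ, fun k => isDistribution_pullback hΨ, hreg,
    lieFlag_pullback hΨ hξ, ⟨hξ.curvatureWellDefined, hreg.curvatureWellDefined⟩,
    ⟨fun i y => congrFun (flagFibre_pullback hΨ hξ i) y, ?_⟩, ?_, ?_⟩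
  · intro i j hi hj y a b
    obtain ⟨p, hp⟩ := hD i
    obtain ⟨q, hq⟩ := hD j
    exact mapQ_curvature_pullback hΨ hi hj hp hq (hL i) (hL j) (lieFlag_pullback hΨ hξ i)
      (lieFlag_pullback hΨ hξ j) _ a b _ _
  · refine exists_congr fun i => ?_
    obtain ⟨p, hp⟩ := hD i
    rw [lieFlag_pullback hΨ hξ, hL, ← sections_top, ← sections_top]
    exact sections_pullback_eq_iff hΨ hφ hp A.isDistribution_top
  · obtain ⟨k, hk⟩ := hξ.1
    refine forall₂_congr fun i _ => ?_
    obtain ⟨p, hp⟩ := hD i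
    rw [lieFlag_pullback hΨ hξ, hL]
    exact sections_pullback_eq_iff hΨ hφ hp hk

end Hom

end LieAlgebroid

namespace LieAlgebroid

namespace Hom

section Forms

variable {E : Type*} [NormedAddCommGroup E] [NormedSpace ℝ E]
  {H : Type*} [TopologicalSpace H] {I : ModelWithCorners ℝ E H}
  {M : Type*} [TopologicalSpace M] [ChartedSpace H M] [IsManifold I ∞ M]
  {E' : Type*} [NormedAddCommGroup E'] [NormedSpace ℝ E'] [FiniteDimensional ℝ E']
  {H' : Type*} [TopologicalSpace H'] {J : ModelWithCorners ℝ E' H'}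
  {N : Type*} [TopologicalSpace N] [ChartedSpace H' N] [IsManifold J ∞ N] [T2Space N]
  {B : LieAlgebroid.{u} J N} {A : LieAlgebroid.{u} I M} {φ : N → M} {Ψ : Hom B A φ}
  (hΨ : Ψ.IsFibrewiseIso)
include hΨ

theorem dOne_pullbackOne_lift {α : A.OneForm}
    (hα : ∀ v : A.Sec, ContMDiff I 𝓘(ℝ, ℝ) ∞ (fun x => α x (v x))) (v w : A.Sec) (y : N) :
    B.dOne (Ψ.pullbackOne α) (lift hΨ v) (lift hΨ w) y = A.dOne α v w (φ y) := by
  simp only [dOne, pullbackOne, LinearMap.comp_apply, bracket_lift, map_lift]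
  rw [lieDeriv_lift hΨ v (hα w), lieDeriv_lift hΨ w (hα v)]

theorem dTwo_pullbackTwo_lift {Ω : A.BilinForm}
    (hΩ : ∀ v w : A.Sec, ContMDiff I 𝓘(ℝ, ℝ) ∞ (fun x => Ω x (v x) (w x))) (u v w : A.Sec)
    (y : N) : B.dTwo (Ψ.pullbackTwo Ω) (lift hΨ u) (lift hΨ v) (lift hΨ w) y =
      A.dTwo Ω u v w (φ y) := by
  simp only [dTwo, pullbackTwo, LinearMap.compl₁₂_apply, bracket_lift, map_lift]
  rw [lieDeriv_lift hΨ u (hΩ v w), lieDeriv_lift hΨ v (hΩ u w), lieDeriv_lift hΨ w (hΩ u v)]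

variable [FiniteDimensional ℝ E] [T2Space M]

/-! ### Pullbacks of contact structures -/

theorem isContactStructure_pullback (hr : B.rank = A.rank) {ξ : A.Family}
    (hξ : A.IsContactStructure ξ) : B.IsContactStructure (Ψ.pullback ξ) := by
  obtain ⟨r, hrk, hD, hnd⟩ := hξ
  have hD1 : A.IsDistribution (A.flagFibre ξ 1) (2 * r) := by rwa [hD.flagFibre_one]
  have hA1 : A.lieFlag ξ 1 = A.sections (A.flagFibre ξ 1) := by
    rw [hD.flagFibre_one]
    rfl
  have hB1 : B.lieFlag (Ψ.pullback ξ) 1 = B.sections (Ψ.pullback (A.flagFibre ξ 1)) := by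
    rw [hD.flagFibre_one]
    rfl
  have hflag : B.flagFibre (Ψ.pullback ξ) 1 = Ψ.pullback (A.flagFibre ξ 1) :=
    flagFibre_eq_of_lieFlag_eq (isDistribution_pullback hΨ hD1) hB1
  refine ⟨r, hr.trans hrk, isDistribution_pullback hΨ hD, fun y a ha => ?_⟩
  have hmem : ∀ b : B.flagFibre (Ψ.pullback ξ) 1 y, Ψ.map y b ∈ A.flagFibre ξ 1 (φ y) :=
    fun b => (congrFun hflag y).le b.2
  have h0 : (⟨Ψ.map y a, hmem a⟩ : A.flagFibre ξ 1 (φ y)) = 0 := by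
    refine hnd (φ y) _ ?_
    rintro ⟨b, hb⟩
    obtain ⟨b, rfl⟩ := (hΨ y).2 b
    have h := mapQ_curvature_pullback hΨ le_rfl le_rfl hD1 hD1 hA1 hA1 hB1 hB1
      (congrFun hflag y).le a ⟨b, (congrFun hflag y).ge hb⟩ (hmem a) hb
    rw [ha, map_zero] at h
    exact h.symm
  exact Subtype.ext ((hΨ y).1 ((congrArg Subtype.val h0).trans (map_zero _).symm))

/-! ### Pullbacks of contact forms -/

theorem contMDiff_pullbackOne {α : A.OneForm}
    (hα : ∀ v : A.Sec, ContMDiff I 𝓘(ℝ, ℝ) ∞ (fun x => α x (v x))) (v : B.Sec) :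
    ContMDiff J 𝓘(ℝ, ℝ) ∞ (fun y => Ψ.pullbackOne α y (v y)) := by
  intro y
  obtain ⟨s, hs⟩ := A.exists_isFrameAt_top (φ y)
  obtain ⟨c, hc⟩ := (isFrameAt_lift hΨ hs).exists_coeff (v := v)
    (Eventually.of_forall fun _ => trivial)
  have hsm : ContMDiffAt J 𝓘(ℝ, ℝ) ∞ (fun z => ∑ i, c i z • α (φ z) (s i (φ z))) y :=
    contMDiffAt_finsetSum fun i _ => (c i).contMDiff.contMDiffAt.smul
      ((hα (s i)).comp Ψ.base_smooth).contMDiffAt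
  refine hsm.congr_of_eventuallyEq ?_
  filter_upwards [hc] with z hz
  simp only [hz, pullbackOne, map_sum, map_smul, LinearMap.comp_apply, map_lift]

theorem isContactForm_pullbackOne (hr : B.rank = A.rank) {α : A.OneForm}
    (hα : A.IsContactForm α) : B.IsContactForm (Ψ.pullbackOne α) := by
  obtain ⟨hsm, r, hrk, hnd⟩ := hα
  refine ⟨contMDiff_pullbackOne hΨ hsm, r, hr.trans hrk, fun y => ?_⟩
  obtain ⟨v, hv⟩ := hnd (φ y)
  refine ⟨fun i => lift hΨ (v i), ?_⟩
  simpa only [dOne_pullbackOne_lift hΨ hsm, pullbackOne, LinearMap.comp_apply, map_lift] using hv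

/-! ### Pullbacks of symplectic forms -/

theorem contMDiff_pullbackTwo {Ω : A.BilinForm}
    (hΩ : ∀ v w : A.Sec, ContMDiff I 𝓘(ℝ, ℝ) ∞ (fun x => Ω x (v x) (w x))) (v w : B.Sec) :
    ContMDiff J 𝓘(ℝ, ℝ) ∞ (fun y => Ψ.pullbackTwo Ω y (v y) (w y)) := by
  intro y
  obtain ⟨s, hs⟩ := A.exists_isFrameAt_top (φ y)
  obtain ⟨c, hc⟩ := (isFrameAt_lift hΨ hs).exists_coeff (v := v)
    (Eventually.of_forall fun _ => trivial)
  obtain ⟨d, hd⟩ := (isFrameAt_lift hΨ hs).exists_coeff (v := w)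
    (Eventually.of_forall fun _ => trivial)
  have hsm : ContMDiffAt J 𝓘(ℝ, ℝ) ∞
      (fun z => ∑ i, c i z • ∑ j, d j z • Ω (φ z) (s i (φ z)) (s j (φ z))) y :=
    contMDiffAt_finsetSum fun i _ => (c i).contMDiff.contMDiffAt.smul <|
      contMDiffAt_finsetSum fun j _ => (d j).contMDiff.contMDiffAt.smul
        ((hΩ (s i) (s j)).comp Ψ.base_smooth).contMDiffAt
  refine hsm.congr_of_eventuallyEq ?_
  filter_upwards [hc, hd] with z hz hz'
  simp only [hz, hz', pullbackTwo, LinearMap.compl₁₂_apply, map_sum, map_smul,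
    LinearMap.sum_apply, LinearMap.smul_apply, map_lift, Finset.smul_sum]
  rw [Finset.sum_comm]
  exact Finset.sum_congr rfl fun i _ => Finset.sum_congr rfl fun j _ => smul_comm _ _ _

theorem isSymplecticForm_pullbackTwo (hr : B.rank = A.rank) {Ω : A.BilinForm}
    (hΩ : A.IsSymplecticForm Ω) : B.IsSymplecticForm (Ψ.pullbackTwo Ω) := by
  obtain ⟨halt, hsm, hcl, r, hrk, hnd⟩ := hΩ
  have halt' : ∀ y a, Ψ.pullbackTwo Ω y a a = 0 := fun y a => halt (φ y) (Ψ.map y a)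
  have hanti : ∀ y a b, Ψ.pullbackTwo Ω y a b = -Ψ.pullbackTwo Ω y b a := fun y a b => by
    have h := halt' y (a + b)
    simp only [map_add, LinearMap.add_apply, halt', zero_add, add_zero] at h
    exact eq_neg_of_add_eq_zero_right h
  refine ⟨halt', contMDiff_pullbackTwo hΨ hsm, fun u v w y => ?_, r, hr.trans hrk, fun y => ?_⟩
  · obtain ⟨s, hs⟩ := A.exists_isFrameAt_top (φ y)
    refine dTwo_eq_zero_of_frame hanti (contMDiff_pullbackTwo hΨ hsm)
      (isFrameAt_lift hΨ hs) (fun i j k => ?_) u v w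
    rw [dTwo_pullbackTwo_lift hΨ hsm, hcl]
  · obtain ⟨v, hv⟩ := hnd (φ y)
    choose v' hv' using fun i => (hΨ y).2 (v i)
    exact ⟨v', by simpa only [pullbackTwo, LinearMap.compl₁₂_apply, hv'] using hv⟩

end Forms

/-! ### Invariance -/

section Invariance

variable {E : Type*} [NormedAddCommGroup E] [NormedSpace ℝ E] [FiniteDimensional ℝ E]
  {H : Type*} [TopologicalSpace H] {I : ModelWithCorners ℝ E H}
  {M : Type*} [TopologicalSpace M] [ChartedSpace H M] [IsManifold I ∞ M] [T2Space M]
  {E' : Type*} [NormedAddCommGroup E'] [NormedSpace ℝ E'] [FiniteDimensional ℝ E']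
  {H' : Type*} [TopologicalSpace H'] {K : ModelWithCorners ℝ E' H'}
  {P : Type*} [TopologicalSpace P] [ChartedSpace H' P] [IsManifold K ∞ P] [T2Space P]
  {F : LieAlgebroid.{u} (I.prod K) (M × P)} {A : LieAlgebroid.{u} I M}
  {Ψ : Hom F A (Prod.fst : M × P → M)} (hΨ : Ψ.IsFibrewiseIso) (hF : F.IsFoliation)
  (hA : ∀ v w : A.Sec, (∀ x, A.anchor x (v x) = A.anchor x (w x)) → v = w)

include hΨ hF in
/-- A family of vectors of a foliation along a slice `M × {q}` whose anchors are smooth is mapped to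
a smooth section. -/
theorem contMDiff_map_of_contMDiff_anchor {q : P} {v : ∀ m, F.Fibre (m, q)}
    (hv : ContMDiff I (I.prod K).tangent ∞
      (fun m => (⟨(m, q), F.anchor (m, q) (v m)⟩ : TangentBundle (I.prod K) (M × P)))) :
    ContMDiff I (I.prod 𝓘(ℝ, A.Model)) ∞
      (fun m => (⟨m, Ψ.map (m, q) (v m)⟩ : TotalSpace A.Model A.Fibre)) := by
  intro m₀
  obtain ⟨s, hs⟩ := A.exists_isFrameAt_top m₀
  obtain ⟨c, hc⟩ := exists_coeff_of_mem_span (fun i m => s i m) (fun m => Ψ.map (m, q) (v m))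
  have hq : ContMDiff I (I.prod K) ∞ (fun m : M => (m, q)) := contMDiff_id.prodMk contMDiff_const
  have hev : ∀ᶠ m in 𝓝 m₀, Ψ.map (m, q) (v m) = ∑ i, c i m • s i m :=
    hs.mono fun m hm => hc m (hm.2 ▸ Submodule.mem_top)
  have hev' : ∀ᶠ m in 𝓝 m₀, v m = ∑ i, c i m • lift hΨ (s i) (m, q) := by
    filter_upwards [hev] with m hm
    refine (hΨ (m, q)).1 (hm.trans ?_)
    simp only [map_sum, map_smul, map_lift]
  have hli : LinearIndependent ℝ (fun i => lift hΨ (s i) (m₀, q)) :=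
    (isFrameAt_lift hΨ (y := (m₀, q)) hs).self_of_nhds.1
  have hcs : ∀ i, ContMDiffAt I 𝓘(ℝ, ℝ) ∞ (c i) m₀ := by
    refine contMDiffAt_coeff_of_sum_smul_section (I := I.prod K) (F := E × E')
      (W := TangentSpace (I.prod K)) (φ := fun m : M => (m, q))
      (s := fun i m => F.anchor (m, q) (lift hΨ (s i) (m, q))) (fun i => ?_)
      (hli.map' _ (LinearMap.ker_eq_bot.2 (hF _))) ?_
    · exact (F.anchor_smooth.comp ((lift hΨ (s i)).contMDiff.comp hq)).contMDiffAt
    · refine hv.contMDiffAt.congr_of_eventuallyEq ?_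
      filter_upwards [hev'] with m hm
      rw [hm]
      simp
  refine (ContMDiffAt.sum_section (s := Finset.univ) (t := fun i m => c i m • s i m)
    fun i _ => (hcs i).smul_section (s i).contMDiff.contMDiffAt).congr_of_eventuallyEq ?_
  filter_upwards [hev] with m hm
  rw [hm]

include hΨ hF hA in
/-- Vectors of an invariant foliation on `M × P` that correspond under a transformation of `P` have
the same image under a fibrewise isomorphism covering the projection to `M`. -/
theorem map_eq_map_of_mfderiv_eq {θ : P → P} (hθ : ContMDiff K K ∞ θ)
    (hinv : ∀ p (e : F.Fibre p), ∃ e' : F.Fibre (p.1, θ p.2), F.anchor (p.1, θ p.2) e' =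
      mfderiv (I.prod K) (I.prod K) (fun p : M × P => (p.1, θ p.2)) p (F.anchor p e))
    {p : M × P} {e : F.Fibre p} {e' : F.Fibre (p.1, θ p.2)}
    (h : F.anchor (p.1, θ p.2) e' =
      mfderiv (I.prod K) (I.prod K) (fun p : M × P => (p.1, θ p.2)) p (F.anchor p e)) :
    (Ψ.map (p.1, θ p.2) e' : A.Fibre p.1) = Ψ.map p e := by
  obtain ⟨m₀, q⟩ := p
  have hτ : ContMDiff (I.prod K) (I.prod K) ∞ (fun p : M × P => (p.1, θ p.2)) :=
    contMDiff_fst.prodMk (hθ.comp contMDiff_snd)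
  have hq : ContMDiff I (I.prod K) ∞ (fun m : M => (m, q)) := contMDiff_id.prodMk contMDiff_const
  obtain ⟨a, ha⟩ := exists_section_apply_eq (A := A) (Ψ.map (m₀, q) e)
  have hae : lift hΨ a (m₀, q) = e := lift_eq_of_map hΨ ha.symm
  choose v hv using fun m => hinv (m, q) (lift hΨ a (m, q))
  have hve : v m₀ = e' := hF _ (by rw [hv, hae]; exact h.symm)
  have hsm : ContMDiff I (I.prod 𝓘(ℝ, A.Model)) ∞
      (fun m => (⟨m, Ψ.map (m, θ q) (v m)⟩ : TotalSpace A.Model A.Fibre)) := by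
    refine contMDiff_map_of_contMDiff_anchor hΨ hF ?_
    simp only [hv]
    exact (hτ.contMDiff_tangentMap (m := ∞) (by simp)).comp
      (F.anchor_smooth.comp ((lift hΨ a).contMDiff.comp hq))
  have heq : (⟨fun m => Ψ.map (m, θ q) (v m), hsm⟩ : A.Sec) = a := by
    refine hA _ _ fun m => ?_
    have hfst : MDifferentiableAt (I.prod K) I (Prod.fst : M × P → M) (m, θ q) :=
      mdifferentiableAt_fst
    have hc : mfderiv (I.prod K) I (Prod.fst : M × P → M) (m, q) =
        (mfderiv (I.prod K) I (Prod.fst : M × P → M) (m, θ q)).comp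
          (mfderiv (I.prod K) (I.prod K) (fun p : M × P => (p.1, θ p.2)) (m, q)) :=
      mfderiv_comp (g := (Prod.fst : M × P → M)) (m, q) hfst
        (hτ.mdifferentiable (by simp) _)
    have h1 := Ψ.anchor_comm (m, q) (lift hΨ a (m, q))
    rw [map_lift, hc] at h1
    refine (Ψ.anchor_comm (m, θ q) (v m)).trans (Eq.trans ?_ h1.symm)
    rw [hv]
    rfl
  rw [← hve, ← ha, ← heq]
  rfl

include hΨ hF hA in
theorem isInvariant_pullback {G : Type*} {θ : G → P → P} (hθ : ∀ t, ContMDiff K K ∞ (θ t))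
    (hinv : F.IsInvariant (fun t p => (p.1, θ t p.2)) (fun _ => ⊤)) (ξ : A.Family) :
    F.IsInvariant (fun t p => (p.1, θ t p.2)) (Ψ.pullback ξ) := by
  intro t p
  have hinv' : ∀ p (e : F.Fibre p), ∃ e' : F.Fibre (p.1, θ t p.2), F.anchor (p.1, θ t p.2) e' =
      mfderiv (I.prod K) (I.prod K) (fun p : M × P => (p.1, θ t p.2)) p (F.anchor p e) := by
    intro p e
    obtain ⟨e', -, he'⟩ := (hinv t p).le
      (Submodule.mem_map_of_mem (Submodule.mem_map_of_mem (Submodule.mem_top (x := e))))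
    exact ⟨e', he'⟩
  apply le_antisymm
  · rintro _ ⟨_, ⟨e, he, rfl⟩, rfl⟩
    obtain ⟨e', he'⟩ := hinv' p e
    refine ⟨e', ?_, he'⟩
    have := map_eq_map_of_mfderiv_eq hΨ hF hA (hθ t) hinv' he'
    change (Ψ.map (p.1, θ t p.2) e' : A.Fibre p.1) ∈ ξ p.1
    rw [this]
    exact he
  · rintro _ ⟨e', he', rfl⟩
    obtain ⟨_, ⟨e, -, rfl⟩, he⟩ := (hinv t p).ge
      (Submodule.mem_map_of_mem (Submodule.mem_top (x := e')))
    have := map_eq_map_of_mfderiv_eq hΨ hF hA (hθ t) hinv' he.symm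
    refine ⟨_, ⟨e, ?_, rfl⟩, he⟩
    change Ψ.map p e ∈ ξ p.1
    rw [← this]
    exact he'

end Invariance

end Hom

end LieAlgebroid

theorem theorem1p2
    {E : Type*} [NormedAddCommGroup E] [NormedSpace ℝ E] [FiniteDimensional ℝ E]
    {H : Type*} [TopologicalSpace H] (I : ModelWithCorners ℝ E H) [I.Boundaryless]
    (M : Type*) [TopologicalSpace M] [ChartedSpace H M] [IsManifold I ∞ M]
    [T2Space M] [SigmaCompactSpace M]
    {E' : Type*} [NormedAddCommGroup E'] [NormedSpace ℝ E'] [FiniteDimensional ℝ E']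
    {H' : Type*} [TopologicalSpace H'] (J : ModelWithCorners ℝ E' H') [J.Boundaryless]
    (N : Type*) [TopologicalSpace N] [ChartedSpace H' N] [IsManifold J ∞ N]
    [T2Space N] [SigmaCompactSpace N] :
    -- general Lie algebroids of the same rank
    (∀ (A : LieAlgebroid.{u} I M) (B : LieAlgebroid.{u} J N) (φ : N → M)
      (Ψ : LieAlgebroid.Hom B A φ), B.rank = A.rank → Ψ.IsSubmersion →
      ∀ ξ : A.Family, A.IsRegular ξ → Ψ.LiftsRegularDistribution ξ) ∧
    -- `b^k`-tangent bundles
    (∀ (k : ℕ) (Z : Set M) (j : JetAlong I Z k) (A : LieAlgebroid.{u} I M),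
      1 ≤ k → IsHypersurface I Z → IsCoorientable I Z → IsAdmissibleJet j →
      IsBkTangentBundle j A →
      -- compact regularisations
      (∀ (F : LieAlgebroid.{u} (I.prod (𝓡 1)) (M × Circle))
        (Ψ : LieAlgebroid.Hom F A Prod.fst), Ψ.IsRegularisation →
        (∀ ξ : A.Family, A.IsContactStructure ξ →
          F.IsContactStructure (Ψ.pullback ξ) ∧ Ψ.IsLift ξ (Ψ.pullback ξ)) ∧
        (∀ α : A.OneForm, A.IsContactForm α → F.IsContactForm (Ψ.pullbackOne α)) ∧
        (∀ Ω : A.BilinForm, A.IsSymplecticForm Ω → F.IsSymplecticForm (Ψ.pullbackTwo Ω)) ∧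
        (∀ ξ : A.Family, A.IsRegular ξ → Ψ.LiftsRegularDistribution ξ ∧
          (F.IsInvariant (circleTranslation M) (fun _ => ⊤) →
            F.IsInvariant (circleTranslation M) (Ψ.pullback ξ)))) ∧
      -- trivial regularisations
      (∀ (F : LieAlgebroid.{u} (I.prod 𝓘(ℝ, ℝ)) (M × ℝ))
        (Ψ : LieAlgebroid.Hom F A Prod.fst), Ψ.IsRegularisation →
        ∀ ξ : A.Family, A.IsRegular ξ → Ψ.LiftsRegularDistribution ξ ∧
          (F.IsInvariant (lineTranslation M) (fun _ => ⊤) →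
            F.IsInvariant (lineTranslation M) (Ψ.pullback ξ)))) := by
  refine ⟨fun A B φ Ψ hr hΨ ξ hξ => Ψ.liftsRegularDistribution (hΨ.isFibrewiseIso hr)
    hΨ.base_surjective hξ, fun k Z j A _ _ _ _ hA => ⟨fun F Ψ hΨ => ?_, fun F Ψ hΨ ξ hξ => ?_⟩⟩
  · have hr : F.rank = A.rank := by
      have := hΨ.codim_one
      rw [Module.finrank_prod, finrank_euclideanSpace_fin] at this
      rw [hA.rank_eq]
      omega
    have hiso := hΨ.submersion.isFibrewiseIso hr
    refine ⟨fun ξ hξ => ⟨LieAlgebroid.Hom.isContactStructure_pullback hiso hr hξ,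
      LieAlgebroid.Hom.isLift_pullback hiso ξ⟩,
      fun α => LieAlgebroid.Hom.isContactForm_pullbackOne hiso hr,
      fun Ω => LieAlgebroid.Hom.isSymplecticForm_pullbackTwo hiso hr, fun ξ hξ =>
      ⟨LieAlgebroid.Hom.liftsRegularDistribution hiso hΨ.submersion.base_surjective hξ,
        fun hinv => LieAlgebroid.Hom.isInvariant_pullback hiso hΨ.foliation hA.anchor_injective
          (θ := fun t s : Circle => t * s) (fun t => contMDiff_mul_left) hinv ξ⟩⟩
  · have hr : F.rank = A.rank := by
      have := hΨ.codim_one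
      rw [Module.finrank_prod, Module.finrank_self] at this
      rw [hA.rank_eq]
      omega
    have hiso := hΨ.submersion.isFibrewiseIso hr
    exact ⟨LieAlgebroid.Hom.liftsRegularDistribution hiso hΨ.submersion.base_surjective hξ,
      fun hinv => LieAlgebroid.Hom.isInvariant_pullback hiso hΨ.foliation hA.anchor_injective
        (θ := fun t s : ℝ => t + s) (fun t => contMDiff_const.add contMDiff_id) hinv ξ⟩
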